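/- Let $\nu\ge 0$ and $D\ge 1$ be integers. For finite $\Lambda\subset\mathbf Z^{\nu}$ let $\mathcal H_\Lambda=\bigotimes_{x\in\Lambda}\mathbf C^{D}$ and $\mathcal A_\Lambda=\mathcal B(\mathcal H_\Lambda)$, with $\mathcal A_{\Lambda_1}\subset\mathcal A_{\Lambda_2}$ for $\Lambda_1\subset\Lambda_2$ through $A\mapsto A\otimes\mathbf 1$, and let $\mathcal A$ be the quasi-local $C^*$-algebra, i.e. the norm completion of $\bigcup_\Lambda\mathcal A_\Lambda$. Let $\Phi$ be an interaction which assigns to every finite $X\subset\mathbf Z^{\nu}$ a self-adjoint $\Phi(X)\in\mathcal A_X$, is translation invariant, satisfies $\Phi(X)=0$ whenever $|X|>2$ (two-body interactions), and is stable: $\sum_{0\ne x\in\mathbf Z^{\nu}}\|\Phi(\{0,x\})\|<\infty$. Put $H_\Lambda=\sum_{X\subset\Lambda}\Phi(X)$ and, for $t\in\mathbf R$ and $A\in\mathcal A$, $$\tau_t^{\Lambda}(A)=e^{itH_\Lambda}Ae^{-itH_\Lambda},\qquad \tau_t(A)=\lim_{\Lambda\nearrow\mathbf Z^{\nu}}\tau^{\Lambda}_t(A)\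 \text{ (norm limit along the finite regions ordered by inclusion)}.$$ Let $\omega$ be a state on $\mathcal A$ (a positive normalized linear functional) and $\omega_t=\omega\circ\tau_t$. For a functional $\varphi$ on $\mathcal A$ let $\varphi_\Lambda$ be the density matrix of its restriction to $\mathcal A_\Lambda$, determined by $\varphi(A)=\mathrm{Tr}_{\mathcal H_\Lambda}(\varphi_\Lambda A)$ for $A\in\mathcal A_\Lambda$. For a density matrix $\rho$ let $S(\rho)=-\mathrm{Tr}(\rho\log\rho)$, with $0\log 0=0$. Let $\Lambda_0\subset\Lambda$ be finite subsets of $\mathbf Z^{\nu}$, let $t\in\mathbf R$, and let $\omega^{\Lambda,t}=e^{-itH_\Lambda}\,\omega_\Lambda\,e^{itH_\Lambda}$. Then the norm limit defining $\tau_t(A)$ exists for every $A\in\mathcal A$, and $$\bigl|S((\omega_t)_\Lambda)-S(\omega^{\Lambda,t})\bigr|\ \le\ |\Lambda_0|\log D\,\sup_{A\in\mathcal A_{\Lambda_0},\ \|A\|=1}\bigl\|\tau_t(A)-\tau_t^{\Lambda}(A)\bigr\|+c_\Lambda,\qquad c_\Lambda=e+2\,|\Lambda\setminus\Lambda_0|\log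 D .$$ -/

import Mathlib

open Filter Topology
open scoped Matrix.Norms.L2Operator

namespace SpinSystem

noncomputable section

/-! ## Local algebras -/

/-- The lattice `ℤ^ν`. -/
abbrev Site (ν : ℕ) : Type := Fin ν → ℤ

/-- Labels of the product basis of `ℋ_Λ = ⨂_{x ∈ Λ} ℂ^D`. -/
abbrev Config {ν : ℕ} (D : ℕ) (Λ : Finset (Site ν)) : Type := ↥Λ → Fin D

/-- The local algebra `𝒜_Λ = ℬ(ℋ_Λ)`, as matrices in the product basis. It carries the operator norm
of the Hilbert space `ℋ_Λ`. -/
abbrev LocalAlgebra {ν : ℕ} (D : ℕ) (Λ : Finset (Site ν)) : Type :=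
  Matrix (Config D Λ) (Config D Λ) ℂ

/-- Restriction of a configuration to a smaller region. -/
def restrict {ν D : ℕ} {Λ₁ Λ₂ : Finset (Site ν)} (h : Λ₁ ⊆ Λ₂) (σ : Config D Λ₂) : Config D Λ₁ :=
  fun x => σ ⟨x.1, h x.2⟩

/-- The configuration on `Λ₂` equal to `ξ` on `Λ₁` and to `σ` outside `Λ₁`. -/
def glue {ν D : ℕ} {Λ₁ Λ₂ : Finset (Site ν)} (ξ : Config D Λ₁) (σ : Config D Λ₂) : Config D Λ₂ :=
  fun x => if hx : x.1 ∈ Λ₁ then ξ ⟨x.1, hx⟩ else σ x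

/-- Two configurations on `Λ₂` agree outside `Λ₁`. -/
def AgreeOff {ν D : ℕ} (Λ₁ : Finset (Site ν)) {Λ₂ : Finset (Site ν)} (σ η : Config D Λ₂) : Prop :=
  ∀ x : ↥Λ₂, x.1 ∉ Λ₁ → σ x = η x

instance {ν D : ℕ} (Λ₁ : Finset (Site ν)) {Λ₂ : Finset (Site ν)} (σ η : Config D Λ₂) :
    Decidable (AgreeOff Λ₁ σ η) := by unfold AgreeOff; infer_instance

theorem AgreeOff.refl {ν D : ℕ} (Λ₁ : Finset (Site ν)) {Λ₂ : Finset (Site ν)} (σ : Config D Λ₂) :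
    AgreeOff Λ₁ σ σ := fun _ _ => rfl

theorem AgreeOff.symm {ν D : ℕ} {Λ₁ Λ₂ : Finset (Site ν)} {σ η : Config D Λ₂}
    (h : AgreeOff Λ₁ σ η) : AgreeOff Λ₁ η σ := fun x hx => (h x hx).symm

theorem AgreeOff.trans {ν D : ℕ} {Λ₁ Λ₂ : Finset (Site ν)} {σ η ζ : Config D Λ₂}
    (h : AgreeOff Λ₁ σ η) (h' : AgreeOff Λ₁ η ζ) : AgreeOff Λ₁ σ ζ :=
  fun x hx => (h x hx).trans (h' x hx)

theorem restrict_glue {ν D : ℕ} {Λ₁ Λ₂ : Finset (Site ν)} (h : Λ₁ ⊆ Λ₂) (ξ : Config D Λ₁)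
    (σ : Config D Λ₂) : restrict h (glue ξ σ) = ξ := by
  funext x
  simp [restrict, glue]

theorem glue_restrict {ν D : ℕ} {Λ₁ Λ₂ : Finset (Site ν)} (h : Λ₁ ⊆ Λ₂) {σ η : Config D Λ₂}
    (hση : AgreeOff Λ₁ σ η) : glue (restrict h η) σ = η := by
  funext x
  by_cases hx : x.1 ∈ Λ₁
  · simp [restrict, glue, hx]
  · simp [glue, hx, hση x hx]

theorem agreeOff_glue {ν D : ℕ} {Λ₁ Λ₂ : Finset (Site ν)} (ξ : Config D Λ₁)
    (σ : Config D Λ₂) : AgreeOff Λ₁ σ (glue ξ σ) := by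
  intro x hx
  simp [glue, hx]

theorem eq_iff_restrict {ν D : ℕ} {Λ₁ Λ₂ : Finset (Site ν)} (h : Λ₁ ⊆ Λ₂) (σ η : Config D Λ₂) :
    σ = η ↔ AgreeOff Λ₁ σ η ∧ restrict h σ = restrict h η := by
  constructor
  · rintro rfl
    exact ⟨AgreeOff.refl _ _, rfl⟩
  · rintro ⟨h1, h2⟩
    rw [← glue_restrict h h1, ← h2, glue_restrict h (AgreeOff.refl _ _)]

/-- The matrix of `A ⊗ 1_{Λ₂ ∖ Λ₁}`. -/
def embedFun {ν D : ℕ} {Λ₁ Λ₂ : Finset (Site ν)} (h : Λ₁ ⊆ Λ₂) (A : LocalAlgebra D Λ₁) :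
    LocalAlgebra D Λ₂ :=
  Matrix.of fun σ η => if AgreeOff Λ₁ σ η then A (restrict h σ) (restrict h η) else 0

theorem embedFun_apply {ν D : ℕ} {Λ₁ Λ₂ : Finset (Site ν)} (h : Λ₁ ⊆ Λ₂) (A : LocalAlgebra D Λ₁)
    (σ η : Config D Λ₂) :
    embedFun h A σ η = if AgreeOff Λ₁ σ η then A (restrict h σ) (restrict h η) else 0 := rfl

theorem embedFun_one {ν D : ℕ} {Λ₁ Λ₂ : Finset (Site ν)} (h : Λ₁ ⊆ Λ₂) :
    embedFun h (1 : LocalAlgebra D Λ₁) = 1 := by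
  ext σ η
  rw [embedFun_apply, Matrix.one_apply, Matrix.one_apply, ← ite_and]
  exact if_congr (eq_iff_restrict h σ η).symm rfl rfl

theorem embedFun_mul {ν D : ℕ} {Λ₁ Λ₂ : Finset (Site ν)} (h : Λ₁ ⊆ Λ₂) (A B : LocalAlgebra D Λ₁) :
    embedFun h (A * B) = embedFun h A * embedFun h B := by
  ext σ η
  rw [embedFun_apply, Matrix.mul_apply, Matrix.mul_apply]
  simp only [embedFun_apply]
  by_cases hση : AgreeOff Λ₁ σ η
  · rw [if_pos hση]
    have h1 : ∀ ζ : Config D Λ₂,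
        ((if AgreeOff Λ₁ σ ζ then A (restrict h σ) (restrict h ζ) else 0) *
          (if AgreeOff Λ₁ ζ η then B (restrict h ζ) (restrict h η) else 0)) =
        if AgreeOff Λ₁ σ ζ then
          A (restrict h σ) (restrict h ζ) * B (restrict h ζ) (restrict h η) else 0 := by
      intro ζ
      by_cases hζ : AgreeOff Λ₁ σ ζ
      · rw [if_pos hζ, if_pos hζ, if_pos (hζ.symm.trans hση)]
      · rw [if_neg hζ, if_neg hζ, zero_mul]
    rw [Finset.sum_congr rfl fun ζ _ => h1 ζ, ← Finset.sum_filter]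
    refine Finset.sum_bij' (fun ξ _ => glue ξ σ) (fun ζ _ => restrict h ζ) ?_ ?_ ?_ ?_ ?_
    · intro ξ _
      exact Finset.mem_filter.2 ⟨Finset.mem_univ _, agreeOff_glue ξ σ⟩
    · intro ζ _
      exact Finset.mem_univ _
    · intro ξ _
      exact restrict_glue h ξ σ
    · intro ζ hζ
      exact glue_restrict h (Finset.mem_filter.1 hζ).2
    · intro ξ _
      simp only [restrict_glue]
  · rw [if_neg hση]
    symm
    refine Finset.sum_eq_zero fun ζ _ => ?_
    by_cases hζ : AgreeOff Λ₁ σ ζ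
    · have hζ' : ¬ AgreeOff Λ₁ ζ η := fun h' => hση (hζ.trans h')
      rw [if_neg hζ', mul_zero]
    · rw [if_neg hζ, zero_mul]

/-- The inclusion `𝒜_{Λ₁} ⊆ 𝒜_{Λ₂}`, `A ↦ A ⊗ 1_{Λ₂ ∖ Λ₁}`, a unital `⋆`-homomorphism. -/
def embed {ν D : ℕ} {Λ₁ Λ₂ : Finset (Site ν)} (h : Λ₁ ⊆ Λ₂) :
    LocalAlgebra D Λ₁ →⋆ₐ[ℂ] LocalAlgebra D Λ₂ where
  toFun := embedFun h
  map_one' := embedFun_one h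
  map_mul' := embedFun_mul h
  map_zero' := by
    ext σ η
    simp [embedFun_apply]
  map_add' A B := by
    ext σ η
    by_cases hση : AgreeOff Λ₁ σ η <;> simp [embedFun_apply, hση]
  commutes' r := by
    have h2 : embedFun h (r • (1 : LocalAlgebra D Λ₁)) = r • embedFun h 1 := by
      ext σ η
      by_cases hση : AgreeOff Λ₁ σ η <;> simp [embedFun_apply, hση]
    rw [Algebra.algebraMap_eq_smul_one, Algebra.algebraMap_eq_smul_one, h2, embedFun_one]
  map_star' A := by
    ext σ η
    rw [Matrix.star_apply, embedFun_apply, embedFun_apply, Matrix.star_apply]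
    by_cases hση : AgreeOff Λ₁ σ η
    · rw [if_pos hση, if_pos hση.symm]
    · have hησ : ¬ AgreeOff Λ₁ η σ := fun h' => hση h'.symm
      rw [if_neg hση, if_neg hησ, star_zero]

theorem embed_apply {ν D : ℕ} {Λ₁ Λ₂ : Finset (Site ν)} (h : Λ₁ ⊆ Λ₂) (A : LocalAlgebra D Λ₁)
    (σ η : Config D Λ₂) :
    embed h A σ η = if AgreeOff Λ₁ σ η then A (restrict h σ) (restrict h η) else 0 := rfl

theorem embed_injective {ν D : ℕ} [NeZero D] {Λ₁ Λ₂ : Finset (Site ν)} (h : Λ₁ ⊆ Λ₂) :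
    Function.Injective (embed (D := D) h) := by
  intro A B hAB
  ext ξ ζ
  have h1 := congrFun (congrFun hAB (glue ξ fun _ => 0)) (glue ζ fun _ => 0)
  have h2 : AgreeOff Λ₁ (glue ξ fun _ => 0 : Config D Λ₂) (glue ζ fun _ => 0) :=
    (agreeOff_glue ξ _).symm.trans (agreeOff_glue ζ _)
  simpa only [embed_apply, if_pos h2, restrict_glue] using h1

theorem norm_embed {ν D : ℕ} [NeZero D] {Λ₁ Λ₂ : Finset (Site ν)} (h : Λ₁ ⊆ Λ₂)
    (A : LocalAlgebra D Λ₁) : ‖embed h A‖ = ‖A‖ :=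
  NonUnitalStarAlgHom.norm_map (embed h) (embed_injective h) A

instance directedSystem (ν D : ℕ) :
    DirectedSystem (fun Λ : Finset (Site ν) => LocalAlgebra D Λ)
      (fun _ _ h => embed (D := D) h) where
  map_self Λ A := by
    ext σ η
    have h1 : AgreeOff Λ σ η := fun x hx => absurd x.2 hx
    rw [embed_apply, if_pos h1]
    rfl
  map_map Λ₃ Λ₂ Λ₁ h₁₂ h₂₃ A := by
    ext σ η
    simp only [embed_apply]
    by_cases h1 : AgreeOff Λ₂ σ η
    · rw [if_pos h1]
      refine if_congr ?_ rfl rfl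
      constructor
      · intro h2 x hx
        by_cases hx' : x.1 ∈ Λ₂
        · exact h2 ⟨x.1, hx'⟩ hx
        · exact h1 x hx'
      · intro h2 x hx
        exact h2 ⟨x.1, h₂₃ x.2⟩ hx
    · have h2 : ¬ AgreeOff Λ₁ σ η := fun h' => h1 fun x hx => h' x fun hx' => hx (h₁₂ hx')
      rw [if_neg h1, if_neg h2]

/-! ## The quasi-local algebra -/

/-- The `⋆`-algebra `⋃_Λ 𝒜_Λ` of strictly local observables: the inductive limit of the local
algebras over the finite regions. -/
def StrictlyLocal (ν D : ℕ) : Type :=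
  DirectLimit (fun Λ : Finset (Site ν) => LocalAlgebra D Λ) (fun _ _ h => embed (D := D) h)

instance (ν D : ℕ) : Ring (StrictlyLocal ν D) :=
  inferInstanceAs (Ring (DirectLimit (fun Λ : Finset (Site ν) => LocalAlgebra D Λ)
    (fun _ _ h => embed (D := D) h)))

instance (ν D : ℕ) : StarRing (StrictlyLocal ν D) :=
  inferInstanceAs (StarRing (DirectLimit (fun Λ : Finset (Site ν) => LocalAlgebra D Λ)
    (fun _ _ h => embed (D := D) h)))

instance (ν D : ℕ) : Algebra ℂ (StrictlyLocal ν D) :=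
  inferInstanceAs (Algebra ℂ (DirectLimit (fun Λ : Finset (Site ν) => LocalAlgebra D Λ)
    (fun _ _ h => embed (D := D) h)))

/-- The class of `A ∈ 𝒜_Λ` among the strictly local observables. -/
def mkLocal {ν D : ℕ} (Λ : Finset (Site ν)) (A : LocalAlgebra D Λ) : StrictlyLocal ν D :=
  (⟦⟨Λ, A⟩⟧ : DirectLimit (fun Λ : Finset (Site ν) => LocalAlgebra D Λ)
    (fun _ _ h => embed (D := D) h))

theorem exists_eq_mkLocal {ν D : ℕ} (a : StrictlyLocal ν D) :
    ∃ (Λ : Finset (Site ν)) (A : LocalAlgebra D Λ), a = mkLocal Λ A :=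
  DirectLimit.exists_eq_mk (f := fun _ _ h => embed (D := D) h) a

theorem exists_eq_mkLocal₂ {ν D : ℕ} (a b : StrictlyLocal ν D) :
    ∃ (Λ : Finset (Site ν)) (A B : LocalAlgebra D Λ), a = mkLocal Λ A ∧ b = mkLocal Λ B :=
  DirectLimit.exists_eq_mk₂ (f := fun _ _ h => embed (D := D) h) a b

theorem mkLocal_embed {ν D : ℕ} {Λ₁ Λ₂ : Finset (Site ν)} (h : Λ₁ ⊆ Λ₂) (A : LocalAlgebra D Λ₁) :
    mkLocal Λ₂ (embed h A) = mkLocal Λ₁ A :=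
  DirectLimit.mk_apply (f := fun _ _ h => embed (D := D) h) Λ₁ Λ₂ A h

theorem mkLocal_zero {ν D : ℕ} (Λ : Finset (Site ν)) :
    mkLocal Λ (0 : LocalAlgebra D Λ) = 0 :=
  (DirectLimit.zero_def (f := fun _ _ h => embed (D := D) h) Λ).symm

theorem mkLocal_one {ν D : ℕ} (Λ : Finset (Site ν)) :
    mkLocal Λ (1 : LocalAlgebra D Λ) = 1 :=
  (DirectLimit.one_def (f := fun _ _ h => embed (D := D) h) Λ).symm

theorem mkLocal_add {ν D : ℕ} (Λ : Finset (Site ν)) (A B : LocalAlgebra D Λ) :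
    mkLocal Λ (A + B) = mkLocal Λ A + mkLocal Λ B :=
  (DirectLimit.add_def (f := fun _ _ h => embed (D := D) h) Λ A B).symm

theorem mkLocal_neg {ν D : ℕ} (Λ : Finset (Site ν)) (A : LocalAlgebra D Λ) :
    mkLocal Λ (-A) = -mkLocal Λ A :=
  (DirectLimit.neg_def (f := fun _ _ h => embed (D := D) h) Λ A).symm

theorem mkLocal_mul {ν D : ℕ} (Λ : Finset (Site ν)) (A B : LocalAlgebra D Λ) :
    mkLocal Λ (A * B) = mkLocal Λ A * mkLocal Λ B :=
  (DirectLimit.mul_def (f := fun _ _ h => embed (D := D) h) Λ A B).symm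

theorem mkLocal_smul {ν D : ℕ} (Λ : Finset (Site ν)) (r : ℂ) (A : LocalAlgebra D Λ) :
    mkLocal Λ (r • A) = r • mkLocal Λ A :=
  (DirectLimit.smul_def (f := fun _ _ h => embed (D := D) h) Λ A r).symm

theorem mkLocal_star {ν D : ℕ} (Λ : Finset (Site ν)) (A : LocalAlgebra D Λ) :
    mkLocal Λ (star A) = star (mkLocal Λ A) :=
  (DirectLimit.star_def (f := fun _ _ h => embed (D := D) h) Λ A).symm

instance (ν D : ℕ) : StarModule ℂ (StrictlyLocal ν D) where
  star_smul r a := by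
    obtain ⟨Λ, A, rfl⟩ := exists_eq_mkLocal a
    rw [← mkLocal_smul, ← mkLocal_star, ← mkLocal_star, star_smul, mkLocal_smul]

/-- The `C⋆`-norm of a strictly local observable, computed in any `𝒜_Λ` that contains it. -/
def localNormFun {ν D : ℕ} [NeZero D] : StrictlyLocal ν D → ℝ :=
  DirectLimit.lift (fun _ _ h => embed (D := D) h) (fun _ A => ‖A‖)
    fun _ _ h A => (norm_embed h A).symm

theorem localNormFun_mk {ν D : ℕ} [NeZero D] (Λ : Finset (Site ν)) (A : LocalAlgebra D Λ) :
    localNormFun (mkLocal Λ A) = ‖A‖ := rfl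

/-- The `C⋆`-norm of the strictly local observables as a ring norm. -/
def localNorm (ν D : ℕ) [NeZero D] : RingNorm (StrictlyLocal ν D) where
  toFun := localNormFun
  map_zero' := by rw [← mkLocal_zero ∅, localNormFun_mk, norm_zero]
  add_le' a b := by
    obtain ⟨Λ, A, B, rfl, rfl⟩ := exists_eq_mkLocal₂ a b
    rw [← mkLocal_add]
    exact norm_add_le A B
  neg' a := by
    obtain ⟨Λ, A, rfl⟩ := exists_eq_mkLocal a
    rw [← mkLocal_neg]
    exact norm_neg A
  mul_le' a b := by
    obtain ⟨Λ, A, B, rfl, rfl⟩ := exists_eq_mkLocal₂ a b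
    rw [← mkLocal_mul]
    exact norm_mul_le A B
  eq_zero_of_map_eq_zero' a ha := by
    obtain ⟨Λ, A, rfl⟩ := exists_eq_mkLocal a
    have h1 : A = 0 := norm_eq_zero.1 ha
    rw [h1, mkLocal_zero]

instance (ν D : ℕ) [NeZero D] : NormedRing (StrictlyLocal ν D) := (localNorm ν D).toNormedRing

theorem norm_mkLocal {ν D : ℕ} [NeZero D] (Λ : Finset (Site ν)) (A : LocalAlgebra D Λ) :
    ‖mkLocal Λ A‖ = ‖A‖ := rfl

instance (ν D : ℕ) [NeZero D] : NormedAlgebra ℂ (StrictlyLocal ν D) where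
  norm_smul_le r a := by
    obtain ⟨Λ, A, rfl⟩ := exists_eq_mkLocal a
    rw [← mkLocal_smul, norm_mkLocal, norm_mkLocal]
    exact norm_smul_le r A

instance (ν D : ℕ) [NeZero D] : CStarRing (StrictlyLocal ν D) where
  norm_mul_self_le a := by
    obtain ⟨Λ, A, rfl⟩ := exists_eq_mkLocal a
    rw [← mkLocal_star, ← mkLocal_mul, norm_mkLocal, norm_mkLocal]
    exact CStarRing.norm_mul_self_le A

/-- The quasi-local algebra `𝒜`: the norm completion of the strictly local observables. -/
def QuasiLocal (ν D : ℕ) [NeZero D] : Type := UniformSpace.Completion (StrictlyLocal ν D)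

instance (ν D : ℕ) [NeZero D] : NormedRing (QuasiLocal ν D) :=
  inferInstanceAs (NormedRing (UniformSpace.Completion (StrictlyLocal ν D)))

instance (ν D : ℕ) [NeZero D] : CompleteSpace (QuasiLocal ν D) :=
  inferInstanceAs (CompleteSpace (UniformSpace.Completion (StrictlyLocal ν D)))

instance (ν D : ℕ) [NeZero D] : Algebra ℂ (QuasiLocal ν D) :=
  inferInstanceAs (Algebra ℂ (UniformSpace.Completion (StrictlyLocal ν D)))

instance (ν D : ℕ) [NeZero D] : NormedAlgebra ℂ (QuasiLocal ν D) where
  norm_smul_le r A := norm_smul_le (β := UniformSpace.Completion (StrictlyLocal ν D)) r A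

/-- The inclusion of the strictly local observables. -/
def ofLocal {ν D : ℕ} [NeZero D] (A : StrictlyLocal ν D) : QuasiLocal ν D :=
  (A : UniformSpace.Completion (StrictlyLocal ν D))

theorem norm_ofLocal {ν D : ℕ} [NeZero D] (A : StrictlyLocal ν D) : ‖ofLocal A‖ = ‖A‖ :=
  UniformSpace.Completion.norm_coe A

theorem denseRange_ofLocal (ν D : ℕ) [NeZero D] :
    DenseRange (ofLocal : StrictlyLocal ν D → QuasiLocal ν D) :=
  UniformSpace.Completion.denseRange_coe

theorem continuous_ofLocal (ν D : ℕ) [NeZero D] :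
    Continuous (ofLocal : StrictlyLocal ν D → QuasiLocal ν D) :=
  UniformSpace.Completion.continuous_coe _

theorem ofLocal_mul {ν D : ℕ} [NeZero D] (A B : StrictlyLocal ν D) :
    ofLocal (A * B) = ofLocal A * ofLocal B := UniformSpace.Completion.coe_mul A B

theorem ofLocal_add {ν D : ℕ} [NeZero D] (A B : StrictlyLocal ν D) :
    ofLocal (A + B) = ofLocal A + ofLocal B := UniformSpace.Completion.coe_add A B

theorem ofLocal_smul {ν D : ℕ} [NeZero D] (r : ℂ) (A : StrictlyLocal ν D) :
    ofLocal (r • A) = r • ofLocal A := UniformSpace.Completion.coe_smul r A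

theorem ofLocal_one (ν D : ℕ) [NeZero D] : ofLocal (1 : StrictlyLocal ν D) = 1 :=
  UniformSpace.Completion.coe_one _

theorem ofLocal_zero (ν D : ℕ) [NeZero D] : ofLocal (0 : StrictlyLocal ν D) = 0 :=
  UniformSpace.Completion.coe_zero

/-- The involution of `𝒜`, the continuous extension of the involution of the local algebras. -/
instance (ν D : ℕ) [NeZero D] : Star (QuasiLocal ν D) where
  star := UniformSpace.Completion.map (star : StrictlyLocal ν D → StrictlyLocal ν D)

theorem continuous_star_quasiLocal (ν D : ℕ) [NeZero D] :
    Continuous (star : QuasiLocal ν D → QuasiLocal ν D) :=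
  UniformSpace.Completion.continuous_map

theorem star_ofLocal {ν D : ℕ} [NeZero D] (A : StrictlyLocal ν D) :
    star (ofLocal A) = ofLocal (star A) :=
  UniformSpace.Completion.map_coe (starₗᵢ ℂ : StrictlyLocal ν D ≃ₗᵢ⋆[ℂ] _).isometry.uniformContinuous A

instance (ν D : ℕ) [NeZero D] : StarRing (QuasiLocal ν D) where
  star_involutive A := by
    have hs := continuous_star_quasiLocal ν D
    refine (denseRange_ofLocal ν D).induction_on A (isClosed_eq (by fun_prop) (by fun_prop)) ?_
    intro a
    rw [star_ofLocal, star_ofLocal, star_star]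
  star_mul A B := by
    have hs := continuous_star_quasiLocal ν D
    refine (denseRange_ofLocal ν D).induction_on₂ (p := fun A B => star (A * B) = star B * star A)
      (isClosed_eq (by fun_prop) (by fun_prop)) ?_ A B
    intro a b
    rw [← ofLocal_mul, star_ofLocal, star_ofLocal, star_ofLocal, star_mul, ofLocal_mul]
  star_add A B := by
    have hs := continuous_star_quasiLocal ν D
    refine (denseRange_ofLocal ν D).induction_on₂ (p := fun A B => star (A + B) = star A + star B)
      (isClosed_eq (by fun_prop) (by fun_prop)) ?_ A B
    intro a b
    rw [← ofLocal_add, star_ofLocal, star_ofLocal, star_ofLocal, star_add, ofLocal_add]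

instance (ν D : ℕ) [NeZero D] : StarModule ℂ (QuasiLocal ν D) where
  star_smul r A := by
    have hs := continuous_star_quasiLocal ν D
    refine (denseRange_ofLocal ν D).induction_on A (isClosed_eq
      (hs.comp (continuous_const_smul r)) (hs.const_smul (star r))) ?_
    intro a
    rw [← ofLocal_smul, star_ofLocal, star_ofLocal, star_smul, ofLocal_smul]

instance (ν D : ℕ) [NeZero D] : CStarRing (QuasiLocal ν D) where
  norm_mul_self_le A := by
    have hs := continuous_star_quasiLocal ν D
    refine (denseRange_ofLocal ν D).induction_on A (isClosed_le (by fun_prop) (by fun_prop)) ?_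
    intro a
    rw [star_ofLocal, ← ofLocal_mul, norm_ofLocal, norm_ofLocal]
    exact CStarRing.norm_mul_self_le a

/-- The quasi-local algebra is a unital `C⋆`-algebra. -/
instance (ν D : ℕ) [NeZero D] : CStarAlgebra (QuasiLocal ν D) where

/-- The inclusion of the local algebra `𝒜_Λ` in the quasi-local algebra `𝒜`. -/
def incl {ν D : ℕ} [NeZero D] (Λ : Finset (Site ν)) : LocalAlgebra D Λ →⋆ₐ[ℂ] QuasiLocal ν D where
  toFun A := ofLocal (mkLocal Λ A)
  map_one' := by rw [mkLocal_one, ofLocal_one]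
  map_mul' A B := by rw [mkLocal_mul, ofLocal_mul]
  map_zero' := by rw [mkLocal_zero, ofLocal_zero]
  map_add' A B := by rw [mkLocal_add, ofLocal_add]
  commutes' r := by
    rw [Algebra.algebraMap_eq_smul_one, Algebra.algebraMap_eq_smul_one, mkLocal_smul,
      ofLocal_smul, mkLocal_one, ofLocal_one]
  map_star' A := by rw [mkLocal_star, star_ofLocal]

/-- The inclusions are isometric. -/
theorem norm_incl {ν D : ℕ} [NeZero D] (Λ : Finset (Site ν)) (A : LocalAlgebra D Λ) :
    ‖incl Λ A‖ = ‖A‖ := norm_ofLocal _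

/-- The inclusions are compatible with `A ↦ A ⊗ 1`. -/
theorem incl_embed {ν D : ℕ} [NeZero D] {Λ₁ Λ₂ : Finset (Site ν)} (h : Λ₁ ⊆ Λ₂)
    (A : LocalAlgebra D Λ₁) : incl Λ₂ (embed h A) = incl Λ₁ A :=
  congrArg ofLocal (mkLocal_embed h A)

/-- The local observables are dense in the quasi-local algebra. -/
theorem dense_local (ν D : ℕ) [NeZero D] :
    Dense {A : QuasiLocal ν D | ∃ (Λ : Finset (Site ν)) (B : LocalAlgebra D Λ), incl Λ B = A} := by
  refine (denseRange_ofLocal ν D).mono ?_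
  rintro _ ⟨a, rfl⟩
  obtain ⟨Λ, B, rfl⟩ := exists_eq_mkLocal a
  exact ⟨Λ, B, rfl⟩

/-! ## Interactions and dynamics -/

/-- The translate `X + x` of a finite region. -/
def translate {ν : ℕ} (x : Site ν) (X : Finset (Site ν)) : Finset (Site ν) :=
  X.map (Equiv.addRight x).toEmbedding

/-- The translate of a site of `X`, as a site of `X + x`. -/
def translateSite {ν : ℕ} (x : Site ν) {X : Finset (Site ν)} (y : ↥X) : ↥(translate x X) :=
  ⟨y.1 + x, Finset.mem_map_of_mem (Equiv.addRight x).toEmbedding y.2⟩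

/-- `Φ` is a self-adjoint, translation-invariant interaction `X ↦ Φ(X) ∈ 𝒜_X` with at most two-body
terms satisfying the stability condition `∑_{x ≠ 0} ‖Φ({0, x})‖ < ∞`. -/
structure IsTwoBodyInteraction {ν D : ℕ} (Φ : (X : Finset (Site ν)) → LocalAlgebra D X) :
    Prop where
  isHermitian : ∀ X, (Φ X).IsHermitian
  translation_invariant : ∀ (x : Site ν) (X : Finset (Site ν)) (σ η : Config D (translate x X)),
    Φ (translate x X) σ η =
      Φ X (fun y => σ (translateSite x y)) (fun y => η (translateSite x y))
  two_body : ∀ X : Finset (Site ν), 2 < X.card → Φ X = 0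
  stable : Summable fun x : {x : Site ν // x ≠ 0} => ‖Φ {0, x.1}‖

/-- The finite-region Hamiltonian `H_Λ = ∑_{X ⊆ Λ} Φ(X) ∈ 𝒜_Λ`. -/
def hamiltonian {ν D : ℕ} (Φ : (X : Finset (Site ν)) → LocalAlgebra D X) (Λ : Finset (Site ν)) :
    LocalAlgebra D Λ :=
  ∑ X ∈ Λ.powerset.attach, embed (Finset.mem_powerset.1 X.2) (Φ X.1)

/-- The finite-region time evolution `τ_t^Λ(A) = exp(i t H_Λ) A exp(-i t H_Λ)` on `𝒜`. -/
def localEvolution {ν D : ℕ} [NeZero D] (Φ : (X : Finset (Site ν)) → LocalAlgebra D X)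
    (Λ : Finset (Site ν)) (t : ℝ) (A : QuasiLocal ν D) : QuasiLocal ν D :=
  NormedSpace.exp ((Complex.I * t) • incl Λ (hamiltonian Φ Λ)) * A *
    NormedSpace.exp (-(Complex.I * t) • incl Λ (hamiltonian Φ Λ))

/-- The infinite-volume time evolution `τ_t(A) = lim_{Λ ↗ ℤ^ν} τ_t^Λ(A)` (norm limit). -/
def evolution {ν D : ℕ} [NeZero D] (Φ : (X : Finset (Site ν)) → LocalAlgebra D X)
    (t : ℝ) (A : QuasiLocal ν D) : QuasiLocal ν D :=
  limUnder atTop fun Λ : Finset (Site ν) => localEvolution Φ Λ t A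

/-! ## States, density matrices and entropy -/

/-- A state: a positive, normalized linear functional on `𝒜`. -/
structure IsState {ν D : ℕ} [NeZero D] (ω : QuasiLocal ν D →ₗ[ℂ] ℂ) : Prop where
  im_eq_zero : ∀ A, (ω (star A * A)).im = 0
  re_nonneg : ∀ A, 0 ≤ (ω (star A * A)).re
  map_one : ω 1 = 1

/-- The density matrix `φ_Λ` of the restriction of a functional `φ` to `𝒜_Λ`; for linear `φ` it is
determined by `Tr(φ_Λ A) = φ(A)` for `A ∈ 𝒜_Λ`. -/
def densityMatrix {ν D : ℕ} [NeZero D] (φ : QuasiLocal ν D → ℂ) (Λ : Finset (Site ν)) :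
    LocalAlgebra D Λ :=
  Matrix.of fun σ η => φ (incl Λ (Matrix.single η σ 1))

theorem trace_densityMatrix_mul {ν D : ℕ} [NeZero D] (φ : QuasiLocal ν D →ₗ[ℂ] ℂ)
    (Λ : Finset (Site ν)) (A : LocalAlgebra D Λ) :
    (densityMatrix φ Λ * A).trace = φ (incl Λ A) := by
  have h1 : incl Λ A = ∑ η, ∑ σ, A η σ • incl Λ (Matrix.single η σ (1 : ℂ)) := by
    conv_lhs => rw [Matrix.matrix_eq_sum_single A]
    simp only [map_sum, ← map_smul, Matrix.smul_single, smul_eq_mul, mul_one]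
  rw [h1]
  simp only [map_sum, map_smul, Matrix.trace, Matrix.diag, Matrix.mul_apply, densityMatrix,
    Matrix.of_apply, smul_eq_mul]
  rw [Finset.sum_comm]
  exact Finset.sum_congr rfl fun η _ => Finset.sum_congr rfl fun σ _ => mul_comm _ _

/-- The finite-volume evolved density matrix `exp(-i t H_Λ) ρ exp(i t H_Λ)`. -/
def evolvedDensity {ν D : ℕ} (Φ : (X : Finset (Site ν)) → LocalAlgebra D X)
    (Λ : Finset (Site ν)) (t : ℝ) (ρ : LocalAlgebra D Λ) : LocalAlgebra D Λ :=
  NormedSpace.exp (-(Complex.I * t) • hamiltonian Φ Λ) * ρ *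
    NormedSpace.exp ((Complex.I * t) • hamiltonian Φ Λ)

/-- The von Neumann entropy `-Tr(ρ log ρ)` of a density matrix, with the convention
`0 log 0 = 0` (the logarithm is applied to the eigenvalues of `ρ`, and `Real.log 0 = 0`). -/
def entropy {ν D : ℕ} {Λ : Finset (Site ν)} (ρ : LocalAlgebra D Λ) : ℝ :=
  -((ρ * CFC.log ρ).trace).re

end

end SpinSystem

/-! The limit exists because nested commutators with the Hamiltonian grow slowly enough. Conjugation
by `exp (i t H)` is the exponential series of the derivation `a ↦ H a - a H`. Applied to an
observable on `Y`, only the terms `Φ X` meeting `Y` survive; by translation invariance their norms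
add up to at most `|Y|` times `siteNorm Φ`, and a two-body term enlarges `Y` by at most one site.
Hence the `n`-fold commutator has norm at most `(2 * siteNorm Φ) ^ n * k (k + 1) ⋯ (k + n - 1) *
‖B‖` for `|Y| ≤ k`, uniformly in the region (`norm_iteratedCommutator_le`). After division by `n!`
this is a binomial coefficient times a geometric term, summable for small `|t|`, and dominated
convergence gives the limit. Density and isometry extend it to every observable, the group law to
every time (`exists_tendsto_localEvolution`).

For the entropy, put `φ = ω ∘ τ_t` and `ψ = ω ∘ τ_t^Λ`. Both are states, and the evolved density
matrix is the density matrix of `ψ` on `Λ` (`evolvedDensity_densityMatrix`). The difference of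
entropies on `Λ` is compared with that on `Λ₀`. Passing from `Λ` to `Λ₀` costs at most `|Λ \ Λ₀| log
D` for each state, which accounts for the factor 2 in the constant. On `Λ₀` a Fannes-type estimate
(`vonNeumannEntropy_sub_le`) bounds the difference by `log dim` times the value of `φ - ψ` on a
self-adjoint observable of norm one, plus `2 log 2 ≤ e`; that value is at most the supremum in the
theorem.

The entropy inequalities rest on one classical fact, `sum_negMulLog_le_of_mixing`: averaging weights
with a substochastic matrix does not lower Shannon entropy. Applied to a matrix with orthogonal rows
it shows that the von Neumann entropy is at most the Shannon entropy of the weights of any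
decomposition into rank-one terms, and at most that of the outcomes of any measurement in an
orthonormal basis. -/

namespace SpinSystem

noncomputable section

/-! ### Conjugation by exponentials as the exponential of a derivation -/

section Flow

variable {𝔄 : Type*} [CStarAlgebra 𝔄]

/-- The derivation `a ↦ h a - a h` as a bounded operator. -/
def commutatorL (h : 𝔄) : 𝔄 →L[ℂ] 𝔄 :=
  ContinuousLinearMap.mul ℂ 𝔄 h - (ContinuousLinearMap.mul ℂ 𝔄).flip h

theorem commutatorL_apply (h a : 𝔄) : commutatorL h a = h * a - a * h := rfl

theorem norm_commutatorL_apply_le (h a : 𝔄) : ‖commutatorL h a‖ ≤ 2 * ‖h‖ * ‖a‖ := by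
  rw [commutatorL_apply]
  have h1 := norm_sub_le (h * a) (a * h)
  have h2 := norm_mul_le h a
  have h3 := norm_mul_le a h
  nlinarith

theorem commutatorL_sum {ι : Type*} (s : Finset ι) (h : ι → 𝔄) (a : 𝔄) :
    commutatorL (∑ i ∈ s, h i) a = ∑ i ∈ s, commutatorL (h i) a := by
  simp only [commutatorL_apply, Finset.sum_mul, Finset.mul_sum, Finset.sum_sub_distrib]

theorem exp_apply_eq_of_pow_apply {T : 𝔄 →L[ℂ] 𝔄} {a b : 𝔄} {f : ℕ → 𝔄}
    (hT : ∀ n, (T ^ n) a = f n) (hf : HasSum (fun n => ((n.factorial : ℂ)⁻¹) • f n) b) :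
    NormedSpace.exp T a = b := by
  have h1 := (NormedSpace.exp_series_hasSum_exp' (𝕂 := ℂ) T).mapL (ContinuousLinearMap.apply ℂ 𝔄 a)
  refine h1.unique ?_
  simpa [hT] using hf

theorem exp_mulLeft_apply (h a : 𝔄) :
    NormedSpace.exp (ContinuousLinearMap.mul ℂ 𝔄 h) a = NormedSpace.exp h * a := by
  refine exp_apply_eq_of_pow_apply (f := fun n => h ^ n * a) (fun n => ?_) ?_
  · induction n with
    | zero => simp
    | succ n ih => rw [pow_succ', mul_apply_eq_comp, ih, pow_succ']; simp [mul_assoc]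
  · simpa using (NormedSpace.exp_series_hasSum_exp' (𝕂 := ℂ) h).mul_right a

theorem exp_mulRight_apply (h a : 𝔄) :
    NormedSpace.exp ((ContinuousLinearMap.mul ℂ 𝔄).flip h) a = a * NormedSpace.exp h := by
  refine exp_apply_eq_of_pow_apply (f := fun n => a * h ^ n) (fun n => ?_) ?_
  · induction n with
    | zero => simp
    | succ n ih => rw [pow_succ', mul_apply_eq_comp, ih, pow_succ]; simp [mul_assoc]
  · simpa using (NormedSpace.exp_series_hasSum_exp' (𝕂 := ℂ) h).mul_left a

/-- Left multiplication by `h` and right multiplication by `-h` commute by associativity, so the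
exponential of their sum factors. -/
theorem exp_conj_eq_exp_commutatorL (h a : 𝔄) :
    NormedSpace.exp h * a * NormedSpace.exp (-h) = NormedSpace.exp (commutatorL h) a := by
  have hc : Commute (ContinuousLinearMap.mul ℂ 𝔄 h)
      ((ContinuousLinearMap.mul ℂ 𝔄).flip (-h)) := by
    ext b
    simp [mul_assoc]
  have h1 : commutatorL h =
      ContinuousLinearMap.mul ℂ 𝔄 h + (ContinuousLinearMap.mul ℂ 𝔄).flip (-h) := by
    ext b
    simp [commutatorL_apply, sub_eq_add_neg]
  let _ : NormedAlgebra ℚ (𝔄 →L[ℂ] 𝔄) := NormedAlgebra.restrictScalars ℚ ℂ _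
  rw [h1, NormedSpace.exp_add_of_commute hc, mul_apply_eq_comp, exp_mulRight_apply,
    exp_mulLeft_apply, mul_assoc]

theorem commutatorL_smul (c : ℂ) (h : 𝔄) : commutatorL (c • h) = c • commutatorL h := by
  ext b
  simp [commutatorL_apply, smul_sub]

theorem hasSum_exp_conj (c : ℂ) (h a : 𝔄) :
    HasSum (fun n : ℕ => ((n.factorial : ℂ)⁻¹ * c ^ n) • (commutatorL h ^ n) a)
      (NormedSpace.exp (c • h) * a * NormedSpace.exp (-c • h)) := by
  have h0 := exp_conj_eq_exp_commutatorL (c • h) a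
  rw [← neg_smul] at h0
  rw [h0, commutatorL_smul]
  have h1 := (NormedSpace.exp_series_hasSum_exp' (𝕂 := ℂ) (c • commutatorL h)).mapL
    (ContinuousLinearMap.apply ℂ 𝔄 a)
  have h2 : ∀ n : ℕ, ((c • commutatorL h) ^ n) a = c ^ n • (commutatorL h ^ n) a := by
    intro n
    induction n with
    | zero => simp
    | succ n ih =>
      rw [pow_succ', mul_apply_eq_comp, ih, pow_succ' (commutatorL h), mul_apply_eq_comp, map_smul,
        smul_apply, smul_smul, pow_succ]
  simpa only [smul_smul, ContinuousLinearMap.apply_apply, smul_apply, h2] using h1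

/-- `exp (i t h)` is unitary for self-adjoint `h`. -/
theorem exp_I_smul_mem_unitary {h : 𝔄} (hh : IsSelfAdjoint h) (t : ℝ) :
    NormedSpace.exp ((Complex.I * t) • h) ∈ unitary 𝔄 := by
  have h1 : IsSelfAdjoint ((t : ℂ) • h) := by
    rw [IsSelfAdjoint, star_smul, hh.star_eq]; simp
  have h2 := (selfAdjoint.expUnitary (⟨_, h1⟩ : selfAdjoint 𝔄)).2
  rw [selfAdjoint.expUnitary_coe] at h2
  simpa [mul_smul] using h2

theorem star_exp_I_smul {h : 𝔄} (hh : IsSelfAdjoint h) (t : ℝ) :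
    star (NormedSpace.exp ((Complex.I * t) • h)) = NormedSpace.exp (-(Complex.I * t) • h) := by
  rw [NormedSpace.star_exp, star_smul, hh.star_eq]
  simp

end Flow

/-! ### Finite-region evolution: a one-parameter family of isometric star-homomorphisms -/

section LocalEvolution

theorem isSelfAdjoint_hamiltonian {ν D : ℕ}
    {Φ : (X : Finset (Site ν)) → LocalAlgebra D X} (hΦ : IsTwoBodyInteraction Φ) (Λ : Finset (Site ν)) :
    IsSelfAdjoint (hamiltonian Φ Λ) := by
  rw [hamiltonian]
  refine isSelfAdjoint_sum _ fun X _ => ?_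
  exact IsSelfAdjoint.map (hΦ.isHermitian X.1).isSelfAdjoint (embed _)

variable {ν D : ℕ} [NeZero D] {Φ : (X : Finset (Site ν)) → LocalAlgebra D X}

theorem incl_hamiltonian (Φ : (X : Finset (Site ν)) → LocalAlgebra D X) (Λ : Finset (Site ν)) :
    incl Λ (hamiltonian Φ Λ) = ∑ X ∈ Λ.powerset, incl X (Φ X) := by
  rw [hamiltonian, map_sum, ← Finset.sum_attach Λ.powerset]
  exact Finset.sum_congr rfl fun X _ => incl_embed _ _

theorem isSelfAdjoint_incl_hamiltonian (hΦ : IsTwoBodyInteraction Φ) (Λ : Finset (Site ν)) :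
    IsSelfAdjoint (incl Λ (hamiltonian Φ Λ)) :=
  (isSelfAdjoint_hamiltonian hΦ Λ).map (incl Λ)

theorem localEvolution_eq_star (hΦ : IsTwoBodyInteraction Φ) (Λ : Finset (Site ν)) (t : ℝ)
    (A : QuasiLocal ν D) :
    localEvolution Φ Λ t A = NormedSpace.exp ((Complex.I * t) • incl Λ (hamiltonian Φ Λ)) * A *
      star (NormedSpace.exp ((Complex.I * t) • incl Λ (hamiltonian Φ Λ))) := by
  rw [star_exp_I_smul (isSelfAdjoint_incl_hamiltonian hΦ Λ)]
  rfl

theorem norm_localEvolution (hΦ : IsTwoBodyInteraction Φ) (Λ : Finset (Site ν)) (t : ℝ)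
    (A : QuasiLocal ν D) : ‖localEvolution Φ Λ t A‖ = ‖A‖ := by
  have hu := exp_I_smul_mem_unitary (isSelfAdjoint_incl_hamiltonian hΦ Λ) t
  rw [localEvolution_eq_star hΦ, CStarRing.norm_mul_mem_unitary _ (Unitary.star_mem hu),
    CStarRing.norm_mem_unitary_mul _ hu]

theorem localEvolution_mul (hΦ : IsTwoBodyInteraction Φ) (Λ : Finset (Site ν)) (t : ℝ)
    (A B : QuasiLocal ν D) :
    localEvolution Φ Λ t (A * B) = localEvolution Φ Λ t A * localEvolution Φ Λ t B := by
  have hu := exp_I_smul_mem_unitary (isSelfAdjoint_incl_hamiltonian hΦ Λ) t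
  simp only [localEvolution_eq_star hΦ]
  generalize NormedSpace.exp ((Complex.I * t) • incl Λ (hamiltonian Φ Λ)) = u at hu
  calc u * (A * B) * star u = u * A * 1 * B * star u := by simp only [mul_assoc, one_mul]
    _ = _ := by rw [← Unitary.star_mul_self_of_mem hu]; simp only [mul_assoc]

theorem localEvolution_one (hΦ : IsTwoBodyInteraction Φ) (Λ : Finset (Site ν)) (t : ℝ) :
    localEvolution Φ Λ t 1 = 1 := by
  have hu := exp_I_smul_mem_unitary (isSelfAdjoint_incl_hamiltonian hΦ Λ) t
  rw [localEvolution_eq_star hΦ, mul_one, Unitary.mul_star_self_of_mem hu]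

theorem localEvolution_star (hΦ : IsTwoBodyInteraction Φ) (Λ : Finset (Site ν)) (t : ℝ)
    (A : QuasiLocal ν D) :
    localEvolution Φ Λ t (star A) = star (localEvolution Φ Λ t A) := by
  simp only [localEvolution_eq_star hΦ, star_mul, star_star, mul_assoc]

theorem localEvolution_add (Φ : (X : Finset (Site ν)) → LocalAlgebra D X) (Λ : Finset (Site ν))
    (t : ℝ) (A B : QuasiLocal ν D) :
    localEvolution Φ Λ t (A + B) = localEvolution Φ Λ t A + localEvolution Φ Λ t B := by
  simp only [localEvolution, mul_add, add_mul]

theorem localEvolution_sub (Φ : (X : Finset (Site ν)) → LocalAlgebra D X) (Λ : Finset (Site ν))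
    (t : ℝ) (A B : QuasiLocal ν D) :
    localEvolution Φ Λ t (A - B) = localEvolution Φ Λ t A - localEvolution Φ Λ t B := by
  simp only [localEvolution, mul_sub, sub_mul]

theorem localEvolution_smul (Φ : (X : Finset (Site ν)) → LocalAlgebra D X) (Λ : Finset (Site ν))
    (t : ℝ) (c : ℂ) (A : QuasiLocal ν D) :
    localEvolution Φ Λ t (c • A) = c • localEvolution Φ Λ t A := by
  simp only [localEvolution, mul_smul_comm, smul_mul_assoc]

theorem localEvolution_zero (Φ : (X : Finset (Site ν)) → LocalAlgebra D X) (Λ : Finset (Site ν))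
    (A : QuasiLocal ν D) : localEvolution Φ Λ 0 A = A := by
  simp [localEvolution, NormedSpace.exp_zero]

theorem localEvolution_add_time (Φ : (X : Finset (Site ν)) → LocalAlgebra D X)
    (Λ : Finset (Site ν)) (s t : ℝ) (A : QuasiLocal ν D) :
    localEvolution Φ Λ (s + t) A = localEvolution Φ Λ s (localEvolution Φ Λ t A) := by
  let _ : NormedAlgebra ℚ (QuasiLocal ν D) := NormedAlgebra.restrictScalars ℚ ℂ _
  simp only [localEvolution]
  generalize incl Λ (hamiltonian Φ Λ) = H
  have hc : ∀ a b : ℂ, Commute (a • H) (b • H) := fun a b =>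
    ((Commute.refl H).smul_left a).smul_right b
  have h1 : (Complex.I * ((s + t : ℝ) : ℂ)) • H = (Complex.I * s) • H + (Complex.I * t) • H := by
    rw [← add_smul]; push_cast; ring_nf
  have h2 : (-(Complex.I * ((s + t : ℝ) : ℂ))) • H =
      (-(Complex.I * t)) • H + (-(Complex.I * s)) • H := by
    rw [← add_smul]; push_cast; ring_nf
  rw [h1, h2, NormedSpace.exp_add_of_commute (hc _ _), NormedSpace.exp_add_of_commute (hc _ _)]
  simp only [mul_assoc]

theorem hasSum_localEvolution (Φ : (X : Finset (Site ν)) → LocalAlgebra D X) (Λ : Finset (Site ν))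
    (t : ℝ) (A : QuasiLocal ν D) :
    HasSum (fun n : ℕ => ((n.factorial : ℂ)⁻¹ * (Complex.I * t) ^ n) •
      (commutatorL (incl Λ (hamiltonian Φ Λ)) ^ n) A) (localEvolution Φ Λ t A) :=
  hasSum_exp_conj _ _ _

end LocalEvolution

/-! ### Summability of the interaction terms that touch a region -/

section Interaction

variable {ν D : ℕ} {Φ : (X : Finset (Site ν)) → LocalAlgebra D X}

/-- Relabelling the basis is an injective star-homomorphism of C⋆-algebras, hence isometric. -/
theorem norm_submatrix_equiv {m n : Type*} [Fintype m] [DecidableEq m] [Fintype n] [DecidableEq n]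
    (e : m ≃ n) (A : Matrix n n ℂ) : ‖A.submatrix e e‖ = ‖A‖ := by
  let f : Matrix n n ℂ →⋆ₐ[ℂ] Matrix m m ℂ :=
    { (Matrix.reindexAlgEquiv ℂ ℂ e.symm).toAlgHom with
      map_star' := fun A => by ext; simp [Matrix.star_apply] }
  have hf : Function.Injective f := (Matrix.reindexAlgEquiv ℂ ℂ e.symm).injective
  exact NonUnitalStarAlgHom.norm_map f hf A

/-- Translation of configurations. -/
def configTranslate {ν : ℕ} (D : ℕ) (x : Site ν) (X : Finset (Site ν)) :
    Config D (translate x X) ≃ Config D X :=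
  Equiv.arrowCongr
    (Equiv.ofBijective (translateSite x (X := X)) ⟨fun y z h => by
      have h1 : y.1 + x = z.1 + x := congrArg Subtype.val h
      exact Subtype.ext (add_right_cancel h1), fun y => by
      obtain ⟨z, hz, hzy⟩ := Finset.mem_map.1 y.2
      exact ⟨⟨z, hz⟩, Subtype.ext hzy⟩⟩).symm (Equiv.refl _)

theorem norm_interaction_translate (hΦ : IsTwoBodyInteraction Φ) (x : Site ν)
    (X : Finset (Site ν)) : ‖Φ (translate x X)‖ = ‖Φ X‖ := by
  have h1 : Φ (translate x X) =
      (Φ X).submatrix (configTranslate D x X) (configTranslate D x X) := by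
    ext σ η
    exact hΦ.translation_invariant x X σ η
  rw [h1, norm_submatrix_equiv]

/-- The strength of the interaction terms that touch `Y`. -/
def touchingNorm (Φ : (X : Finset (Site ν)) → LocalAlgebra D X) (Y X : Finset (Site ν)) : ℝ :=
  if Disjoint X Y then 0 else ‖Φ X‖

theorem touchingNorm_nonneg (Y X : Finset (Site ν)) : 0 ≤ touchingNorm Φ Y X := by
  unfold touchingNorm
  split_ifs
  exacts [le_rfl, norm_nonneg _]

/-- The only sets containing 0 that carry interaction have at most two points, hence are the `{0,
x}`, each for exactly one `x`. Stability covers `x ≠ 0`; the value `x = 0` adds the single term `Φ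
{0}`. -/
theorem summable_touchingNorm_zero (hΦ : IsTwoBodyInteraction Φ) :
    Summable (touchingNorm Φ {0}) := by
  have hinj : Function.Injective fun x : Site ν => ({0, x} : Finset (Site ν)) := by
    intro x y hxy
    have hx : x ∈ ({0, y} : Finset (Site ν)) := by
      rw [← show ({0, x} : Finset (Site ν)) = {0, y} from hxy]; simp
    have hy : y ∈ ({0, x} : Finset (Site ν)) := by
      rw [show ({0, x} : Finset (Site ν)) = {0, y} from hxy]; simp
    simp only [Finset.mem_insert, Finset.mem_singleton] at hx hy
    rcases hx with rfl | rfl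
    · rcases hy with rfl | rfl <;> rfl
    · rfl
  refine (hinj.summable_iff fun X hX => ?_).1 ?_
  · unfold touchingNorm
    split_ifs with hd
    · rfl
    · rw [Finset.disjoint_singleton_right, not_not] at hd
      rcases lt_or_ge 2 X.card with hc | hc
      · rw [hΦ.two_body X hc, norm_zero]
      · exfalso
        apply hX
        have h1 : (X.erase 0).card ≤ 1 := by rw [Finset.card_erase_of_mem hd]; omega
        rcases Finset.card_le_one_iff_subset_singleton.1 h1 with ⟨x, hx⟩
        rcases Finset.subset_singleton_iff.1 hx with h2 | h2
        · exact ⟨0, by rw [← Finset.insert_erase hd, h2]; simp⟩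
        · exact ⟨x, by rw [← Finset.insert_erase hd, h2]⟩
  · have h1 : Summable fun x : {x : Site ν // x ∉ ({0} : Finset (Site ν))} =>
        touchingNorm Φ {0} {0, x.1} := by
      have h2 := (Equiv.subtypeEquivRight (p := fun x : Site ν => x ∉ ({0} : Finset (Site ν)))
        (q := fun x => x ≠ 0) (by simp)).summable_iff.2 hΦ.stable
      refine h2.congr fun x => ?_
      simp only [touchingNorm, Finset.disjoint_singleton_right, Finset.mem_insert_self, not_true,
        if_false, Function.comp_apply]
      rfl
    exact (Finset.summable_compl_iff {0}).1 h1

/-- The total strength `∑_{X ∋ 0} ‖Φ(X)‖` of the interaction at a site. -/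
def siteNorm (Φ : (X : Finset (Site ν)) → LocalAlgebra D X) : ℝ := ∑' X, touchingNorm Φ {0} X

theorem siteNorm_nonneg (Φ : (X : Finset (Site ν)) → LocalAlgebra D X) : 0 ≤ siteNorm Φ :=
  tsum_nonneg fun _ => touchingNorm_nonneg _ _

theorem hasSum_touchingNorm_singleton (hΦ : IsTwoBodyInteraction Φ) (y : Site ν) :
    HasSum (touchingNorm Φ {y}) (siteNorm Φ) := by
  have h1 := (summable_touchingNorm_zero hΦ).hasSum
  refine (Equiv.hasSum_iff (Equiv.finsetCongr (Equiv.addRight y))).1 ?_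
  refine h1.congr_fun fun X => ?_
  change touchingNorm Φ {y} (translate y X) = _
  simp only [touchingNorm, norm_interaction_translate hΦ, Finset.disjoint_singleton_right]
  refine if_congr ?_ rfl rfl
  simp [translate]

theorem touchingNorm_le_sum (Y X : Finset (Site ν)) :
    touchingNorm Φ Y X ≤ ∑ y ∈ Y, touchingNorm Φ {y} X := by
  by_cases hd : Disjoint X Y
  · rw [touchingNorm, if_pos hd]
    exact Finset.sum_nonneg fun _ _ => touchingNorm_nonneg _ _
  · obtain ⟨y, hyX, hyY⟩ := Finset.not_disjoint_iff.1 hd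
    have h1 : touchingNorm Φ Y X = touchingNorm Φ {y} X := by
      rw [touchingNorm, touchingNorm, if_neg hd, if_neg (by simpa using hyX)]
    rw [h1]
    exact Finset.single_le_sum (f := fun y => touchingNorm Φ {y} X)
      (fun _ _ => touchingNorm_nonneg _ _) hyY

theorem hasSum_sum_touchingNorm (hΦ : IsTwoBodyInteraction Φ) (Y : Finset (Site ν)) :
    HasSum (fun X => ∑ y ∈ Y, touchingNorm Φ {y} X) (Y.card * siteNorm Φ) := by
  have h1 := hasSum_sum (s := Y) fun y _ => hasSum_touchingNorm_singleton hΦ y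
  simpa using h1

theorem summable_touchingNorm (hΦ : IsTwoBodyInteraction Φ) (Y : Finset (Site ν)) :
    Summable (touchingNorm Φ Y) :=
  (hasSum_sum_touchingNorm hΦ Y).summable.of_nonneg_of_le (touchingNorm_nonneg Y)
    (touchingNorm_le_sum Y)

theorem tsum_touchingNorm_le (hΦ : IsTwoBodyInteraction Φ) (Y : Finset (Site ν)) :
    ∑' X, touchingNorm Φ Y X ≤ Y.card * siteNorm Φ :=
  hasSum_le (touchingNorm_le_sum Y) (summable_touchingNorm hΦ Y).hasSum
    (hasSum_sum_touchingNorm hΦ Y)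

end Interaction

/-! ### Commutator bounds and the infinite-volume limit -/

section Locality

variable {ν D : ℕ}

/-- The matrix product sums over intermediate configurations, but only one contributes: it follows
the column index on `X` and the row index elsewhere. The resulting entry is symmetric in the two
factors. -/
theorem commute_embed {X Y Z : Finset (Site ν)} (hX : X ⊆ Z) (hY : Y ⊆ Z) (h : Disjoint X Y)
    (A : LocalAlgebra D X) (B : LocalAlgebra D Y) : Commute (embed hX A) (embed hY B) := by
  have key : ∀ {X Y : Finset (Site ν)} (hX : X ⊆ Z) (hY : Y ⊆ Z) (_ : Disjoint X Y)
      (A : LocalAlgebra D X) (B : LocalAlgebra D Y) (σ η : Config D Z),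
      (embed hX A * embed hY B) σ η =
        if AgreeOff (X ∪ Y) σ η then
          A (restrict hX σ) (restrict hX η) * B (restrict hY σ) (restrict hY η) else 0 := by
    intro X Y hX hY h A B σ η
    rw [Matrix.mul_apply]
    have hval : ∀ y ∈ Y, y ∉ X := fun y hy hx => Finset.disjoint_left.1 h hx hy
    have hne : ∀ ζ : Config D Z, ζ ≠ glue (restrict hX η) σ → embed hX A σ ζ * embed hY B ζ η = 0 := by
      intro ζ hζ
      rw [embed_apply, embed_apply]
      split_ifs with h1 h2
      · exfalso
        apply hζ
        funext z
        by_cases hz : z.1 ∈ X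
        · rw [h2 z fun hy => hval _ hy hz]
          simp [glue, hz, restrict]
        · rw [← h1 z hz]
          simp [glue, hz]
      all_goals simp
    rw [Finset.sum_eq_single (glue (restrict hX η) σ) (fun ζ _ => hne ζ) (by simp), embed_apply,
      if_pos (agreeOff_glue _ _), embed_apply, restrict_glue]
    have h3 : restrict hY (glue (restrict hX η) σ) = restrict hY σ := by
      funext y
      simp [restrict, glue, hval y.1 y.2]
    rw [h3, mul_ite, mul_zero]
    refine if_congr ?_ rfl rfl
    constructor
    · intro h4 z hz
      rw [Finset.mem_union, not_or] at hz
      rw [← h4 z hz.2]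
      simp [glue, hz.1]
    · intro h4 z hz
      by_cases hzX : z.1 ∈ X
      · simp [glue, hzX, restrict]
      · rw [← h4 z (by simp [hz, hzX])]
        simp [glue, hzX]
  rw [commute_iff_eq]
  ext σ η
  rw [key hX hY h, key hY hX h.symm, Finset.union_comm]
  exact if_congr Iff.rfl (mul_comm _ _) rfl

variable [NeZero D]

theorem commute_incl {X Y : Finset (Site ν)} (h : Disjoint X Y)
    (A : LocalAlgebra D X) (B : LocalAlgebra D Y) : Commute (incl X A) (incl Y B) := by
  rw [← incl_embed (Finset.subset_union_left (s₂ := Y)) A,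
    ← incl_embed (Finset.subset_union_right (s₁ := X)) B]
  exact (commute_embed _ _ h A B).map (incl (X ∪ Y))

theorem exists_commutatorL_incl (X Y : Finset (Site ν)) (A : LocalAlgebra D X)
    (B : LocalAlgebra D Y) :
    ∃ C : LocalAlgebra D (X ∪ Y), commutatorL (incl X A) (incl Y B) = incl (X ∪ Y) C := by
  rw [← incl_embed (Finset.subset_union_left (s₂ := Y)) A,
    ← incl_embed (Finset.subset_union_right (s₁ := X)) B]
  exact ⟨embed Finset.subset_union_left A * embed Finset.subset_union_right B -
    embed Finset.subset_union_right B * embed Finset.subset_union_left A, by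
    simp only [commutatorL_apply, map_sub, map_mul]⟩

variable {Φ : (X : Finset (Site ν)) → LocalAlgebra D X}

theorem commutatorL_incl_of_disjoint {X Y : Finset (Site ν)} (h : Disjoint X Y)
    (A : LocalAlgebra D X) (B : LocalAlgebra D Y) : commutatorL (incl X A) (incl Y B) = 0 := by
  rw [commutatorL_apply, (commute_incl h A B).eq, sub_self]

theorem norm_commutatorL_interaction_le (X Y : Finset (Site ν)) (B : LocalAlgebra D Y) :
    ‖commutatorL (incl X (Φ X)) (incl Y B)‖ ≤ 2 * touchingNorm Φ Y X * ‖B‖ := by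
  unfold touchingNorm
  split_ifs with h
  · rw [commutatorL_incl_of_disjoint h]; simp
  · simpa only [norm_incl] using norm_commutatorL_apply_le (incl X (Φ X)) (incl Y B)

/-- The `n`-fold commutator of `A` with the Hamiltonian of the region `Λ`. -/
def iteratedCommutator (Φ : (X : Finset (Site ν)) → LocalAlgebra D X) (Λ : Finset (Site ν))
    (n : ℕ) : QuasiLocal ν D →L[ℂ] QuasiLocal ν D :=
  commutatorL (incl Λ (hamiltonian Φ Λ)) ^ n

theorem iteratedCommutator_succ (Λ : Finset (Site ν)) (n : ℕ) (A : QuasiLocal ν D) :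
    iteratedCommutator Φ Λ (n + 1) A =
      ∑ X ∈ Λ.powerset, iteratedCommutator Φ Λ n (commutatorL (incl X (Φ X)) A) := by
  rw [iteratedCommutator, pow_succ, mul_apply_eq_comp, incl_hamiltonian, commutatorL_sum, map_sum,
    ← incl_hamiltonian]
  rfl

/-- The inductive step for one interaction term: the inner commutator is again local, on `X ∪ Y`, so
a bound for `n` commutators on slightly larger regions applies to it. -/
theorem norm_iteratedCommutator_commutatorL_le (hΦ : IsTwoBodyInteraction Φ)
    (Λ X Y : Finset (Site ν)) (B : LocalAlgebra D Y) (n : ℕ) {c : ℝ}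
    (hc : ∀ (Z : Finset (Site ν)) (C : LocalAlgebra D Z), Z.card ≤ Y.card + 1 →
      ‖iteratedCommutator Φ Λ n (incl Z C)‖ ≤ c * ‖C‖) (hc0 : 0 ≤ c) :
    ‖iteratedCommutator Φ Λ n (commutatorL (incl X (Φ X)) (incl Y B))‖ ≤
      2 * c * ‖B‖ * touchingNorm Φ Y X := by
  have h0 : 0 ≤ 2 * c * ‖B‖ * touchingNorm Φ Y X := by
    have := touchingNorm_nonneg (Φ := Φ) Y X
    positivity
  by_cases hd : Disjoint X Y
  · rw [commutatorL_incl_of_disjoint hd, map_zero, norm_zero]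
    exact h0
  by_cases h2 : 2 < X.card
  · rw [hΦ.two_body X h2, map_zero, commutatorL_apply]
    simpa using h0
  obtain ⟨C, hC⟩ := exists_commutatorL_incl X Y (Φ X) B
  have h3 := norm_commutatorL_interaction_le (Φ := Φ) X Y B
  rw [hC] at h3 ⊢
  rw [norm_incl] at h3
  refine (hc (X ∪ Y) C ?_).trans ?_
  · have h4 := Finset.card_union_add_card_inter X Y
    have h5 : 0 < (X ∩ Y).card := by
      rw [Finset.card_pos, ← Finset.not_disjoint_iff_nonempty_inter]
      exact hd
    omega
  · calc c * ‖C‖ ≤ c * (2 * touchingNorm Φ Y X * ‖B‖) := mul_le_mul_of_nonneg_left h3 hc0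
      _ = _ := by ring

/-- The innermost commutator is expanded first: it costs a factor `2 * k * siteNorm Φ` and replaces
`k` by `k + 1`. Allowing any `k` above the size of `Y` makes the induction insensitive to the exact
size of the union. -/
theorem norm_iteratedCommutator_le (hΦ : IsTwoBodyInteraction Φ) (Λ : Finset (Site ν)) (n : ℕ) :
    ∀ (k : ℕ) (Y : Finset (Site ν)) (B : LocalAlgebra D Y), Y.card ≤ k →
      ‖iteratedCommutator Φ Λ n (incl Y B)‖ ≤
        (2 * siteNorm Φ) ^ n * k.ascFactorial n * ‖B‖ := by
  have hK := siteNorm_nonneg Φ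
  induction n with
  | zero =>
    intro k Y B _
    simp [iteratedCommutator, norm_incl]
  | succ n ih =>
    intro k Y B hk
    set c : ℝ := (2 * siteNorm Φ) ^ n * (k + 1).ascFactorial n with hc
    have hc0 : 0 ≤ c := by positivity
    rw [iteratedCommutator_succ]
    calc ‖∑ X ∈ Λ.powerset, iteratedCommutator Φ Λ n (commutatorL (incl X (Φ X)) (incl Y B))‖
        ≤ ∑ X ∈ Λ.powerset, 2 * c * ‖B‖ * touchingNorm Φ Y X := by
          refine (norm_sum_le _ _).trans (Finset.sum_le_sum fun X _ => ?_)
          exact norm_iteratedCommutator_commutatorL_le hΦ Λ X Y B n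
            (fun Z C hZ => ih (k + 1) Z C (by omega)) hc0
      _ = 2 * c * ‖B‖ * ∑ X ∈ Λ.powerset, touchingNorm Φ Y X := by rw [Finset.mul_sum]
      _ ≤ 2 * c * ‖B‖ * (k * siteNorm Φ) := by
          refine mul_le_mul_of_nonneg_left ?_ (by positivity)
          refine ((summable_touchingNorm hΦ Y).sum_le_tsum _
            fun _ _ => touchingNorm_nonneg _ _).trans ?_
          refine (tsum_touchingNorm_le hΦ Y).trans ?_
          exact mul_le_mul_of_nonneg_right (by exact_mod_cast hk) hK
      _ = (2 * siteNorm Φ) ^ (n + 1) * k.ascFactorial (n + 1) * ‖B‖ := by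
          have h1 : ((k.ascFactorial (n + 1) : ℕ) : ℝ) = k * (k + 1).ascFactorial n := by
            rw [Nat.ascFactorial_succ, ← Nat.succ_ascFactorial]
            push_cast
            rfl
          rw [h1, hc]
          ring

/-- By induction each summand labelled by `X` converges; the sum over `X ⊆ Λ` then converges by
domination with the summable `touchingNorm Φ Y`. -/
theorem exists_tendsto_iteratedCommutator (hΦ : IsTwoBodyInteraction Φ) (n : ℕ) :
    ∀ (Y : Finset (Site ν)) (B : LocalAlgebra D Y), ∃ L : QuasiLocal ν D,
      Tendsto (fun Λ => iteratedCommutator Φ Λ n (incl Y B)) atTop (𝓝 L) := by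
  induction n with
  | zero => exact fun Y B => ⟨incl Y B, by simp [iteratedCommutator]⟩
  | succ n ih =>
    intro Y B
    have h1 : ∀ X : Finset (Site ν), ∃ L : QuasiLocal ν D, Tendsto (fun Λ =>
        iteratedCommutator Φ Λ n (commutatorL (incl X (Φ X)) (incl Y B))) atTop (𝓝 L) := by
      intro X
      obtain ⟨C, hC⟩ := exists_commutatorL_incl X Y (Φ X) B
      rw [hC]
      exact ih (X ∪ Y) C
    choose L hL using h1
    refine ⟨∑' X, L X, ?_⟩
    -- Extension by zero moves the dependence of the index set on `Λ` into the summand, as dominated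
    -- convergence requires; each `X` lies in `Λ` eventually.
    have h2 : ∀ Λ : Finset (Site ν), iteratedCommutator Φ Λ (n + 1) (incl Y B) =
        ∑' X, if X ∈ Λ.powerset then
          iteratedCommutator Φ Λ n (commutatorL (incl X (Φ X)) (incl Y B)) else 0 := by
      intro Λ
      rw [iteratedCommutator_succ, tsum_eq_sum (s := Λ.powerset) fun X hX => if_neg hX]
      exact Finset.sum_congr rfl fun X hX => (if_pos hX).symm
    simp_rw [h2]
    set c : ℝ := (2 * siteNorm Φ) ^ n * (Y.card + 1).ascFactorial n with hc
    have hc0 : 0 ≤ c := by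
      have := siteNorm_nonneg Φ
      positivity
    refine tendsto_tsum_of_dominated_convergence
      (bound := fun X => 2 * c * ‖B‖ * touchingNorm Φ Y X)
      ((summable_touchingNorm hΦ Y).mul_left _) (fun X => ?_) (Eventually.of_forall fun Λ X => ?_)
    · refine (hL X).congr' ?_
      filter_upwards [eventually_ge_atTop X] with Λ hΛ
      rw [if_pos (Finset.mem_powerset.2 hΛ)]
    · split_ifs
      · exact norm_iteratedCommutator_commutatorL_le hΦ Λ X Y B n
          (fun Z C hZ => norm_iteratedCommutator_le hΦ Λ n _ Z C hZ) hc0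
      · rw [norm_zero]
        have := touchingNorm_nonneg (Φ := Φ) Y X
        positivity

theorem exists_tendsto_localEvolution_of_small (hΦ : IsTwoBodyInteraction Φ) {t : ℝ}
    (ht : |t| * (2 * siteNorm Φ) < 1) (Y : Finset (Site ν)) (B : LocalAlgebra D Y) :
    ∃ L : QuasiLocal ν D,
      Tendsto (fun Λ => localEvolution Φ Λ t (incl Y B)) atTop (𝓝 L) := by
  have hK := siteNorm_nonneg Φ
  choose L hL using fun n => exists_tendsto_iteratedCommutator hΦ n Y B
  refine ⟨∑' n : ℕ, ((n.factorial : ℂ)⁻¹ * (Complex.I * t) ^ n) • L n, ?_⟩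
  simp_rw [fun Λ => ((hasSum_localEvolution Φ Λ t (incl Y B)).tsum_eq).symm]
  have hs : Summable fun n : ℕ =>
      ‖B‖ * (((n + Y.card).choose Y.card : ℝ) * (|t| * (2 * siteNorm Φ)) ^ n) := by
    have hr : ‖|t| * (2 * siteNorm Φ)‖ < 1 := by
      rwa [Real.norm_of_nonneg (by positivity)]
    exact (summable_choose_mul_geometric_of_norm_lt_one Y.card hr).mul_left ‖B‖
  refine tendsto_tsum_of_dominated_convergence hs (fun n => (hL n).const_smul _)
    (Eventually.of_forall fun Λ n => ?_)
  -- The weaker bound with `|Y| + 1` makes the rising factorial equal to `n!` times `(n +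
  -- |Y|).choose |Y|`, matching the summable majorant.
  have h1 := norm_iteratedCommutator_le hΦ Λ n (Y.card + 1) Y B (by omega)
  rw [norm_smul]
  have h2 : ‖((n.factorial : ℂ)⁻¹ * (Complex.I * t) ^ n)‖ = (n.factorial : ℝ)⁻¹ * |t| ^ n := by
    simp
  have h3 : (((Y.card + 1).ascFactorial n : ℕ) : ℝ) =
      n.factorial * ((n + Y.card).choose Y.card : ℝ) := by
    rw [Nat.ascFactorial_eq_factorial_mul_choose, ← Nat.choose_symm_add, add_comm, Nat.cast_mul]
  have h4 : (n.factorial : ℝ) ≠ 0 := by positivity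
  rw [h2]
  calc (n.factorial : ℝ)⁻¹ * |t| ^ n * ‖iteratedCommutator Φ Λ n (incl Y B)‖
      ≤ (n.factorial : ℝ)⁻¹ * |t| ^ n *
        ((2 * siteNorm Φ) ^ n * (Y.card + 1).ascFactorial n * ‖B‖) :=
        mul_le_mul_of_nonneg_left h1 (by positivity)
    _ = _ := by
        rw [h3, mul_pow |t|]
        field_simp

/-- Every finite-region evolution is isometric, so approximating `A` by a local observable gives an
error uniform in the region. -/
theorem exists_tendsto_localEvolution_small (hΦ : IsTwoBodyInteraction Φ) {t : ℝ}
    (ht : |t| * (2 * siteNorm Φ) < 1) (A : QuasiLocal ν D) :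
    ∃ L : QuasiLocal ν D, Tendsto (fun Λ => localEvolution Φ Λ t A) atTop (𝓝 L) := by
  refine cauchySeq_tendsto_of_complete (Metric.cauchySeq_iff.2 fun ε hε => ?_)
  obtain ⟨_, hB, Y, B, rfl⟩ := Metric.dense_iff.1 (dense_local ν D) A (ε / 3) (by positivity)
  obtain ⟨L, hL⟩ := exists_tendsto_localEvolution_of_small hΦ ht Y B
  obtain ⟨N, hN⟩ := Metric.cauchySeq_iff.1 hL.cauchySeq (ε / 3) (by positivity)
  refine ⟨N, fun Λ₁ h₁ Λ₂ h₂ => ?_⟩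
  have hd : ∀ Λ, dist (localEvolution Φ Λ t A) (localEvolution Φ Λ t (incl Y B)) < ε / 3 := by
    intro Λ
    rw [dist_eq_norm, ← localEvolution_sub, norm_localEvolution hΦ, ← dist_eq_norm, dist_comm]
    exact hB
  have h3 := dist_triangle4 (localEvolution Φ Λ₁ t A) (localEvolution Φ Λ₁ t (incl Y B))
    (localEvolution Φ Λ₂ t (incl Y B)) (localEvolution Φ Λ₂ t A)
  have h4 := hd Λ₁
  have h5 := hd Λ₂
  rw [dist_comm] at h5
  have h6 := hN Λ₁ h₁ Λ₂ h₂
  linarith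

theorem exists_tendsto_localEvolution (hΦ : IsTwoBodyInteraction Φ) (t : ℝ)
    (A : QuasiLocal ν D) :
    ∃ L : QuasiLocal ν D, Tendsto (fun Λ => localEvolution Φ Λ t A) atTop (𝓝 L) := by
  have hK := siteNorm_nonneg Φ
  -- Time `t` is cut into `N` equal steps, each inside the radius of convergence.
  obtain ⟨N, hN⟩ := exists_nat_gt (|t| * (2 * siteNorm Φ))
  have hN0 : (0 : ℝ) < N := lt_of_le_of_lt (by positivity) hN
  set s : ℝ := t / N with hs
  have hs1 : |s| * (2 * siteNorm Φ) < 1 := by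
    rw [hs, abs_div, abs_of_pos hN0, div_mul_eq_mul_div, div_lt_one hN0]
    exact hN
  have key : ∀ m : ℕ, ∃ L : QuasiLocal ν D,
      Tendsto (fun Λ => localEvolution Φ Λ (m * s) A) atTop (𝓝 L) := by
    intro m
    induction m with
    | zero => exact ⟨A, by simp [localEvolution_zero]⟩
    | succ m ih =>
      obtain ⟨L, hL⟩ := ih
      obtain ⟨L', hL'⟩ := exists_tendsto_localEvolution_small hΦ hs1 L
      refine ⟨L', ?_⟩
      have h1 : Tendsto (fun Λ => localEvolution Φ Λ (m * s) A - L) atTop (𝓝 0) := by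
        simpa using hL.sub_const L
      -- Evolution and argument both vary with `Λ`; isometry makes the error from replacing the
      -- argument by its limit `L` tend to zero.
      have h2 : Tendsto (fun Λ => localEvolution Φ Λ s (localEvolution Φ Λ (m * s) A - L)) atTop
          (𝓝 0) := by
        rw [tendsto_zero_iff_norm_tendsto_zero] at h1 ⊢
        simpa only [norm_localEvolution hΦ] using h1
      have h3 := h2.add hL'
      rw [zero_add] at h3
      refine h3.congr fun Λ => ?_
      rw [localEvolution_sub, sub_add_cancel, ← localEvolution_add_time]
      congr 1
      push_cast
      ring
  have h1 : (N : ℝ) * s = t := by rw [hs]; field_simp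
  rw [← h1]
  exact key N

theorem tendsto_localEvolution (hΦ : IsTwoBodyInteraction Φ) (t : ℝ) (A : QuasiLocal ν D) :
    Tendsto (fun Λ => localEvolution Φ Λ t A) atTop (𝓝 (evolution Φ t A)) := by
  obtain ⟨L, hL⟩ := exists_tendsto_localEvolution hΦ t A
  rw [evolution, hL.limUnder_eq]
  exact hL

section

variable (hΦ : IsTwoBodyInteraction Φ) (t : ℝ)
include hΦ

theorem evolution_add (A B : QuasiLocal ν D) :
    evolution Φ t (A + B) = evolution Φ t A + evolution Φ t B :=
  tendsto_nhds_unique (tendsto_localEvolution hΦ t _) <| by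
    simpa only [localEvolution_add] using
      (tendsto_localEvolution hΦ t A).add (tendsto_localEvolution hΦ t B)

theorem evolution_smul (c : ℂ) (A : QuasiLocal ν D) :
    evolution Φ t (c • A) = c • evolution Φ t A :=
  tendsto_nhds_unique (tendsto_localEvolution hΦ t _) <| by
    simpa only [localEvolution_smul] using (tendsto_localEvolution hΦ t A).const_smul c

theorem evolution_mul (A B : QuasiLocal ν D) :
    evolution Φ t (A * B) = evolution Φ t A * evolution Φ t B :=
  tendsto_nhds_unique (tendsto_localEvolution hΦ t _) <| by
    simpa only [localEvolution_mul hΦ] using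
      (tendsto_localEvolution hΦ t A).mul (tendsto_localEvolution hΦ t B)

theorem evolution_star (A : QuasiLocal ν D) :
    evolution Φ t (star A) = star (evolution Φ t A) :=
  tendsto_nhds_unique (tendsto_localEvolution hΦ t _) <| by
    simpa only [localEvolution_star hΦ, Function.comp_def] using
      ((continuous_star_quasiLocal ν D).tendsto _).comp (tendsto_localEvolution hΦ t A)

theorem evolution_one : evolution Φ t (1 : QuasiLocal ν D) = 1 :=
  tendsto_nhds_unique (tendsto_localEvolution hΦ t _) <| by
    simpa only [localEvolution_one hΦ] using tendsto_const_nhds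

theorem norm_evolution (A : QuasiLocal ν D) : ‖evolution Φ t A‖ = ‖A‖ :=
  tendsto_nhds_unique (tendsto_localEvolution hΦ t A).norm <| by
    simpa only [norm_localEvolution hΦ] using tendsto_const_nhds

end

end Locality

/-! ### Inequalities for Shannon entropy -/

section Classical

open Real

/-- Jensen for subnormalized weights: after dividing by the total weight `m`, rescaling leaves an
extra term proportional to `negMulLog m`, nonnegative because `m ≤ 1`. -/
theorem sum_mul_negMulLog_le {ι : Type*} (s : Finset ι) (c r : ι → ℝ) (hc : ∀ i ∈ s, 0 ≤ c i)
    (hr : ∀ i ∈ s, 0 ≤ r i) (h1 : ∑ i ∈ s, c i ≤ 1) :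
    ∑ i ∈ s, c i * negMulLog (r i) ≤ negMulLog (∑ i ∈ s, c i * r i) := by
  rcases (Finset.sum_nonneg hc).eq_or_lt with h0 | h0
  · have h2 : ∀ i ∈ s, c i = 0 := (Finset.sum_eq_zero_iff_of_nonneg hc).1 h0.symm
    rw [Finset.sum_eq_zero fun i hi => by rw [h2 i hi, zero_mul],
      Finset.sum_eq_zero fun i hi => by rw [h2 i hi, zero_mul], negMulLog_zero]
  · set m := ∑ i ∈ s, c i with hm
    have h2 := concaveOn_negMulLog.le_map_sum (t := s) (w := fun i => c i / m) (p := r)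
      (fun i hi => div_nonneg (hc i hi) h0.le)
      (by rw [← Finset.sum_div, div_self h0.ne']) (fun i hi => hr i hi)
    simp only [smul_eq_mul] at h2
    have h3 : ∀ f : ι → ℝ, m * ∑ i ∈ s, c i / m * f i = ∑ i ∈ s, c i * f i := by
      intro f
      rw [Finset.mul_sum]
      exact Finset.sum_congr rfl fun i _ => by field_simp
    have h4 : 0 ≤ ∑ i ∈ s, c i / m * r i :=
      Finset.sum_nonneg fun i hi => mul_nonneg (div_nonneg (hc i hi) h0.le) (hr i hi)
    rw [← h3, ← h3 r, negMulLog_mul]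
    have h5 := mul_le_mul_of_nonneg_left h2 h0.le
    have h6 := mul_nonneg h4 (negMulLog_nonneg h0.le h1)
    linarith

theorem negMulLog_sum_le {ι : Type*} (s : Finset ι) (x : ι → ℝ) (hx : ∀ i ∈ s, 0 ≤ x i) :
    negMulLog (∑ i ∈ s, x i) ≤ ∑ i ∈ s, negMulLog (x i) := by
  have h1 : negMulLog (∑ i ∈ s, x i) = ∑ i ∈ s, -(x i * log (∑ j ∈ s, x j)) := by
    rw [negMulLog, Finset.sum_neg_distrib, ← Finset.sum_mul, neg_mul]
  rw [h1]
  refine Finset.sum_le_sum fun i hi => ?_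
  rw [negMulLog, neg_mul, neg_le_neg_iff]
  rcases (hx i hi).eq_or_lt with h0 | h0
  · rw [← h0]; simp
  · exact mul_le_mul_of_nonneg_left (log_le_log h0 (Finset.single_le_sum hx hi)) h0.le

/-- Jensen with uniform weights: for a fixed total, entropy is largest when the mass is spread
equally. -/
theorem sum_negMulLog_le {ι : Type*} [Fintype ι] [Nonempty ι] (x : ι → ℝ) (hx : ∀ i, 0 ≤ x i) :
    ∑ i, negMulLog (x i) ≤ negMulLog (∑ i, x i) + (∑ i, x i) * log (Fintype.card ι) := by
  have hd : (0 : ℝ) < Fintype.card ι := by exact_mod_cast Fintype.card_pos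
  have h1 := concaveOn_negMulLog.le_map_sum (t := Finset.univ)
    (w := fun _ : ι => (Fintype.card ι : ℝ)⁻¹) (p := x)
    (fun _ _ => (inv_pos.2 hd).le) (by simp) (fun i _ => hx i)
  simp only [smul_eq_mul, ← Finset.mul_sum] at h1
  rw [negMulLog_mul, negMulLog, log_inv] at h1
  have h2 := mul_le_mul_of_nonneg_left h1 hd.le
  field_simp at h2
  linarith

theorem negMulLog_add_le {a b : ℝ} (ha : 0 ≤ a) (hb : 0 ≤ b) :
    negMulLog a + negMulLog b ≤ negMulLog (a + b) + (a + b) * log 2 := by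
  have h := sum_negMulLog_le ![a, b] (by
    intro i
    fin_cases i
    exacts [ha, hb])
  simpa using h

theorem sum_negMulLog_le_of_mixing {ι κ : Type*} [Fintype ι] [Fintype κ] (r : ι → ℝ) (p : κ → ℝ)
    (c : ι → κ → ℝ) (hr : ∀ i, 0 ≤ r i) (hc : ∀ i k, 0 ≤ c i k)
    (hp : ∀ k, p k = ∑ i, c i k * r i) (hc1 : ∀ k, ∑ i, c i k ≤ 1)
    (hc2 : ∀ i, r i ≠ 0 → ∑ k, c i k = 1) :
    ∑ i, negMulLog (r i) ≤ ∑ k, negMulLog (p k) := by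
  calc ∑ i, negMulLog (r i) = ∑ i, ∑ k, c i k * negMulLog (r i) := by
        refine Finset.sum_congr rfl fun i _ => ?_
        rw [← Finset.sum_mul]
        by_cases h : r i = 0
        · rw [h, negMulLog_zero, mul_zero]
        · rw [hc2 i h, one_mul]
    _ = ∑ k, ∑ i, c i k * negMulLog (r i) := Finset.sum_comm
    _ ≤ ∑ k, negMulLog (p k) := by
        refine Finset.sum_le_sum fun k _ => ?_
        rw [hp k]
        exact sum_mul_negMulLog_le _ _ _ (fun i _ => hc i k) (fun i _ => hr i) (hc1 k)

end Classical

/-! ### Von Neumann entropy, rank-one decompositions and partial traces -/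

section Quantum

open Matrix Real
open scoped ComplexOrder

variable {m n κ : Type*} [Fintype m] [DecidableEq m] [Fintype n] [DecidableEq n]
  [Fintype κ]

theorem mul_conjTranspose_self_apply {n κ : Type*} [Fintype κ] (W : Matrix n κ ℂ) (i : n) :
    (W * Wᴴ) i i = ((∑ k, ‖W i k‖ ^ 2 : ℝ) : ℂ) := by
  rw [mul_apply]
  push_cast
  exact Finset.sum_congr rfl fun k _ => by
    rw [conjTranspose_apply, Complex.star_def, Complex.mul_conj']

theorem conjTranspose_mul_self_apply {n κ : Type*} [Fintype n] (W : Matrix n κ ℂ) (k : κ) :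
    (Wᴴ * W) k k = ((∑ i, ‖W i k‖ ^ 2 : ℝ) : ℂ) := by
  rw [mul_apply]
  push_cast
  exact Finset.sum_congr rfl fun i _ => by
    rw [conjTranspose_apply, Complex.star_def, Complex.conj_mul']

/-- Bessel's inequality for the columns of a matrix with orthogonal rows. -/
theorem sum_div_le_one_of_mul_conjTranspose_eq_diagonal (W : Matrix n κ ℂ) (r : n → ℝ)
    (hW : W * Wᴴ = diagonal fun i => (r i : ℂ)) (k : κ) : ∑ i, ‖W i k‖ ^ 2 / r i ≤ 1 := by
  have hr : ∀ i, ∑ k, ‖W i k‖ ^ 2 = r i := fun i => by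
    have h := mul_conjTranspose_self_apply W i
    rw [hW, diagonal_apply_eq] at h
    exact_mod_cast h.symm
  set s := ∑ i, ‖W i k‖ ^ 2 / r i with hs
  -- These are the coefficients of the projection of the `k`-th basis vector onto the span of the
  -- rows. The projection has both `k`-th coordinate and squared length equal to `s`, whence `s ^ 2
  -- ≤ s`. Rows with `r i = 0` drop out, since division by zero gives zero.
  set w : n → ℂ := fun i => star (W i k) / r i with hw
  have h1 : (w ᵥ* W) k = (s : ℂ) := by
    rw [vecMul, dotProduct, hs]
    push_cast
    refine Finset.sum_congr rfl fun i _ => ?_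
    rw [hw, ← Complex.conj_mul', Complex.star_def]
    ring
  have h2 : (w ᵥ* W) ⬝ᵥ star (w ᵥ* W) = (s : ℂ) := by
    rw [star_vecMul, dotProduct_mulVec, vecMul_vecMul, hW, dotProduct, hs]
    push_cast
    refine Finset.sum_congr rfl fun i _ => ?_
    rw [vecMul_diagonal, hw, ← Complex.conj_mul']
    simp only [Pi.star_apply, star_div₀, Complex.star_def, Complex.conj_ofReal, Complex.conj_conj]
    by_cases h : (r i : ℂ) = 0
    · simp [h]
    · field_simp
  have h3 : (w ᵥ* W) ⬝ᵥ star (w ᵥ* W) = ((∑ l, ‖(w ᵥ* W) l‖ ^ 2 : ℝ) : ℂ) := by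
    rw [dotProduct]
    push_cast
    exact Finset.sum_congr rfl fun l _ => by
      rw [Pi.star_apply, Complex.star_def, Complex.mul_conj']
  rw [h2] at h3
  have h4 : s = ∑ l, ‖(w ᵥ* W) l‖ ^ 2 := by exact_mod_cast h3
  have h5 : ‖(w ᵥ* W) k‖ ^ 2 ≤ s := by
    rw [h4]
    exact Finset.single_le_sum (f := fun l => ‖(w ᵥ* W) l‖ ^ 2) (fun _ _ => by positivity)
      (Finset.mem_univ k)
  rw [h1, Complex.norm_real, norm_eq_abs, sq_abs] at h5
  nlinarith

/-- The mixing coefficients are `‖W i k‖ ^ 2 / r i`: Bessel bounds the sum over `i`, and the sum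
over `k` is one because `r i` is the squared length of row `i`. -/
theorem sum_negMulLog_le_of_mul_conjTranspose_eq_diagonal (W : Matrix n κ ℂ) (r : n → ℝ)
    (hW : W * Wᴴ = diagonal fun i => (r i : ℂ)) :
    ∑ i, negMulLog (r i) ≤ ∑ k, negMulLog (∑ i, ‖W i k‖ ^ 2) := by
  have hr : ∀ i, ∑ k, ‖W i k‖ ^ 2 = r i := fun i => by
    have h := mul_conjTranspose_self_apply W i
    rw [hW, diagonal_apply_eq] at h
    exact_mod_cast h.symm
  have hr0 : ∀ i, 0 ≤ r i := fun i => by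
    rw [← hr i]; positivity
  refine sum_negMulLog_le_of_mixing r _ (fun i k => ‖W i k‖ ^ 2 / r i) hr0
    (fun i k => div_nonneg (by positivity) (hr0 i)) (fun k => ?_)
    (sum_div_le_one_of_mul_conjTranspose_eq_diagonal W r hW) (fun i hi => ?_)
  · refine Finset.sum_congr rfl fun i _ => ?_
    by_cases h : r i = 0
    · have h1 := hr i
      rw [h, Finset.sum_eq_zero_iff_of_nonneg fun _ _ => by positivity] at h1
      rw [h1 k (Finset.mem_univ k), h]
      simp
    · field_simp
  · rw [← Finset.sum_div, hr i, div_self hi]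

/-- The von Neumann entropy `-Tr(M log M)` of a matrix. -/
def vonNeumannEntropy (M : Matrix n n ℂ) : ℝ := -((M * CFC.log M).trace).re

theorem eq_eigenvectorUnitary_mul {M : Matrix n n ℂ} (hM : M.IsHermitian) :
    M = (hM.eigenvectorUnitary : Matrix n n ℂ) * diagonal (fun i => (hM.eigenvalues i : ℂ)) *
      (hM.eigenvectorUnitary : Matrix n n ℂ)ᴴ := by
  have h := hM.spectral_theorem
  rw [Unitary.conjStarAlgAut_apply] at h
  exact h

theorem eigenvectorUnitary_conj_mul {M : Matrix n n ℂ} (hM : M.IsHermitian) :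
    (hM.eigenvectorUnitary : Matrix n n ℂ)ᴴ * M * (hM.eigenvectorUnitary : Matrix n n ℂ) =
      diagonal (fun i => (hM.eigenvalues i : ℂ)) := by
  have hU : (hM.eigenvectorUnitary : Matrix n n ℂ)ᴴ * (hM.eigenvectorUnitary : Matrix n n ℂ) = 1 :=
    Unitary.star_mul_self_of_mem hM.eigenvectorUnitary.2
  have h := eq_eigenvectorUnitary_mul hM
  set U : Matrix n n ℂ := hM.eigenvectorUnitary.1
  calc Uᴴ * M * U = Uᴴ * (U * diagonal (fun i => (hM.eigenvalues i : ℂ)) * Uᴴ) * U := by rw [← h]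
    _ = (Uᴴ * U) * diagonal (fun i => (hM.eigenvalues i : ℂ)) * (Uᴴ * U) := by
        simp only [Matrix.mul_assoc]
    _ = _ := by rw [hU, Matrix.one_mul, Matrix.mul_one]

theorem vonNeumannEntropy_eq_sum {M : Matrix n n ℂ} (hM : M.IsHermitian) :
    vonNeumannEntropy M = ∑ i, negMulLog (hM.eigenvalues i) := by
  have h1 : CFC.log M = (hM.eigenvectorUnitary : Matrix n n ℂ) *
      diagonal (fun i => (log (hM.eigenvalues i) : ℂ)) *
      (hM.eigenvectorUnitary : Matrix n n ℂ)ᴴ := by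
    rw [CFC.log, hM.cfc_eq, IsHermitian.cfc, Unitary.conjStarAlgAut_apply]
    rfl
  rw [vonNeumannEntropy, h1, ← Matrix.mul_assoc, trace_mul_comm, ← Matrix.mul_assoc,
    ← Matrix.mul_assoc, eigenvectorUnitary_conj_mul hM, diagonal_mul_diagonal, trace_diagonal,
    Complex.re_sum, ← Finset.sum_neg_distrib]
  refine Finset.sum_congr rfl fun i _ => ?_
  rw [← Complex.ofReal_mul, Complex.ofReal_re, negMulLog, neg_mul]

/-- The entropy of `∑ₖ |vₖ⟩⟨vₖ|` is at most the Shannon entropy of the weights `‖vₖ‖²`. -/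
theorem vonNeumannEntropy_mul_conjTranspose_le (V : Matrix n κ ℂ) :
    vonNeumannEntropy (V * Vᴴ) ≤ ∑ k, negMulLog (∑ i, ‖V i k‖ ^ 2) := by
  have hM : (V * Vᴴ).IsHermitian := isHermitian_mul_conjTranspose_self V
  have hU : (hM.eigenvectorUnitary : Matrix n n ℂ) * (hM.eigenvectorUnitary : Matrix n n ℂ)ᴴ = 1 :=
    Unitary.mul_star_self_of_mem hM.eigenvectorUnitary.2
  have hD := eigenvectorUnitary_conj_mul hM
  rw [vonNeumannEntropy_eq_sum hM]
  set U : Matrix n n ℂ := hM.eigenvectorUnitary.1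
  -- In the eigenbasis of `V * Vᴴ` the rows of `V` are orthogonal with squared lengths the
  -- eigenvalues; the rotation leaves the column lengths unchanged.
  have h1 : (Uᴴ * V) * (Uᴴ * V)ᴴ = diagonal fun i => (hM.eigenvalues i : ℂ) := by
    rw [← hD, conjTranspose_mul, conjTranspose_conjTranspose]
    simp only [Matrix.mul_assoc]
  refine (sum_negMulLog_le_of_mul_conjTranspose_eq_diagonal _ _ h1).trans_eq ?_
  refine Finset.sum_congr rfl fun k _ => congrArg _ ?_
  have h2 : (Uᴴ * V)ᴴ * (Uᴴ * V) = Vᴴ * V := by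
    rw [conjTranspose_mul, conjTranspose_conjTranspose, Matrix.mul_assoc, ← Matrix.mul_assoc U, hU,
      Matrix.one_mul]
  have h3 := conjTranspose_mul_self_apply (Uᴴ * V) k
  rw [h2, conjTranspose_mul_self_apply] at h3
  exact_mod_cast h3.symm

theorem exists_conj_diagonal_eq_mul_conjTranspose {U : Matrix n n ℂ} (hU : Uᴴ * U = 1) (r : n → ℝ)
    (hr : ∀ i, 0 ≤ r i) :
    ∃ V : Matrix n n ℂ, U * diagonal (fun i => (r i : ℂ)) * Uᴴ = V * Vᴴ ∧
      Vᴴ * V = diagonal fun i => (r i : ℂ) := by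
  have hS : (diagonal fun i => (√(r i) : ℂ))ᴴ = diagonal fun i => (√(r i) : ℂ) := by
    rw [diagonal_conjTranspose]
    congr 1
    ext i
    simp
  have hSS : (diagonal fun i => (√(r i) : ℂ)) * (diagonal fun i => (√(r i) : ℂ)) =
      diagonal fun i => (r i : ℂ) := by
    rw [diagonal_mul_diagonal]
    congr 1
    ext i
    rw [← Complex.ofReal_mul, mul_self_sqrt (hr i)]
  refine ⟨U * diagonal fun i => (√(r i) : ℂ), ?_, ?_⟩
  · rw [conjTranspose_mul, hS, ← hSS]
    simp only [Matrix.mul_assoc]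
  · rw [conjTranspose_mul, hS, Matrix.mul_assoc, ← Matrix.mul_assoc Uᴴ, hU, Matrix.one_mul, hSS]

theorem sum_norm_sq_eq_of_conjTranspose_mul_self {V : Matrix n n ℂ} {r : n → ℝ}
    (hV : Vᴴ * V = diagonal fun i => (r i : ℂ)) (k : n) : ∑ i, ‖V i k‖ ^ 2 = r k := by
  have h1 := conjTranspose_mul_self_apply V k
  rw [hV, diagonal_apply_eq] at h1
  exact_mod_cast h1.symm

/-- A positive matrix as `V Vᴴ`, where the columns of `V` are rescaled eigenvectors. -/
theorem exists_eq_mul_conjTranspose {M : Matrix n n ℂ} (hM : M.PosSemidef) :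
    ∃ V : Matrix n n ℂ, M = V * Vᴴ ∧
      ∀ k, ∑ i, ‖V i k‖ ^ 2 = hM.isHermitian.eigenvalues k := by
  obtain ⟨V, hV1, hV2⟩ := exists_conj_diagonal_eq_mul_conjTranspose
    (Unitary.star_mul_self_of_mem hM.isHermitian.eigenvectorUnitary.2) _ hM.eigenvalues_nonneg
  exact ⟨V, (eq_eigenvectorUnitary_mul hM.isHermitian).trans hV1,
    sum_norm_sq_eq_of_conjTranspose_mul_self hV2⟩

/-- Measuring in an orthonormal basis does not decrease the entropy. -/
theorem vonNeumannEntropy_le_of_basis {M : Matrix n n ℂ} (hM : M.PosSemidef) (F : Matrix n κ ℂ)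
    (hF : F * Fᴴ = 1) :
    vonNeumannEntropy M ≤ ∑ k, negMulLog ((Fᴴ * M * F) k k).re := by
  have hU : (hM.isHermitian.eigenvectorUnitary : Matrix n n ℂ)ᴴ *
      (hM.isHermitian.eigenvectorUnitary : Matrix n n ℂ) = 1 :=
    Unitary.star_mul_self_of_mem hM.isHermitian.eigenvectorUnitary.2
  obtain ⟨V, hV1, hV2⟩ := exists_conj_diagonal_eq_mul_conjTranspose hU _ hM.eigenvalues_nonneg
  rw [← eq_eigenvectorUnitary_mul hM.isHermitian] at hV1
  rw [vonNeumannEntropy_eq_sum hM.isHermitian]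
  -- Since `F * Fᴴ = 1`, the rows of `Vᴴ * F` inherit orthogonality from the columns of `V`, while
  -- its column weights are the measurement probabilities.
  have h1 : (Vᴴ * F) * (Vᴴ * F)ᴴ = diagonal fun i => (hM.isHermitian.eigenvalues i : ℂ) := by
    rw [conjTranspose_mul, conjTranspose_conjTranspose, Matrix.mul_assoc, ← Matrix.mul_assoc F, hF,
      Matrix.one_mul, hV2]
  refine (sum_negMulLog_le_of_mul_conjTranspose_eq_diagonal _ _ h1).trans_eq ?_
  refine Finset.sum_congr rfl fun k _ => congrArg _ ?_
  have h2 : (Vᴴ * F)ᴴ * (Vᴴ * F) = Fᴴ * M * F := by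
    rw [hV1, conjTranspose_mul, conjTranspose_conjTranspose]
    simp only [Matrix.mul_assoc]
  rw [← h2, conjTranspose_mul_self_apply, Complex.ofReal_re]

theorem vonNeumannEntropy_submatrix_le {M : Matrix n n ℂ} (hM : M.PosSemidef) (e : m ≃ n) :
    vonNeumannEntropy (M.submatrix e e) ≤ vonNeumannEntropy M := by
  obtain ⟨V, hV, hVr⟩ := exists_eq_mul_conjTranspose hM
  have h1 : M.submatrix e e = V.submatrix e id * (V.submatrix e id)ᴴ := by
    rw [conjTranspose_submatrix, ← submatrix_mul V Vᴴ e id e Function.bijective_id, ← hV]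
  rw [h1, vonNeumannEntropy_eq_sum hM.isHermitian]
  refine (vonNeumannEntropy_mul_conjTranspose_le _).trans_eq ?_
  refine Finset.sum_congr rfl fun k _ => congrArg _ ?_
  rw [← hVr k]
  exact e.sum_comp fun i => ‖V i k‖ ^ 2

theorem vonNeumannEntropy_submatrix {M : Matrix n n ℂ} (hM : M.PosSemidef) (e : m ≃ n) :
    vonNeumannEntropy (M.submatrix e e) = vonNeumannEntropy M := by
  refine le_antisymm (vonNeumannEntropy_submatrix_le hM e) ?_
  have h := vonNeumannEntropy_submatrix_le (hM.submatrix e) e.symm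
  simpa using h

theorem sum_eigenvalues_eq_re_trace {M : Matrix n n ℂ} (hM : M.IsHermitian) :
    ∑ i, hM.eigenvalues i = M.trace.re := by
  rw [hM.trace_eq_sum_eigenvalues]
  simp

/-- The partial trace over the second factor. -/
def partialTrace (M : Matrix (m × n) (m × n) ℂ) : Matrix m m ℂ :=
  of fun i j => ∑ k, M (i, k) (j, k)

/-- Each rescaled eigenvector splits into one vector per basis label of the traced-out factor. These
vectors decompose the partial trace, and splitting a weight into `card n` parts raises entropy by at
most the weight times `log (card n)`. -/
theorem vonNeumannEntropy_partialTrace_le [Nonempty n] {M : Matrix (m × n) (m × n) ℂ}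
    (hM : M.PosSemidef) :
    vonNeumannEntropy (partialTrace M) ≤
      vonNeumannEntropy M + M.trace.re * log (Fintype.card n) := by
  obtain ⟨V, hV, hVr⟩ := exists_eq_mul_conjTranspose hM
  set W : Matrix m ((m × n) × n) ℂ := of fun i lk => V (i, lk.2) lk.1 with hW
  have h1 : partialTrace M = W * Wᴴ := by
    ext i j
    rw [partialTrace, of_apply, mul_apply, Fintype.sum_prod_type_right]
    refine Finset.sum_congr rfl fun k _ => ?_
    conv_lhs => rw [hV]
    rfl
  rw [h1]
  refine (vonNeumannEntropy_mul_conjTranspose_le W).trans ?_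
  rw [Fintype.sum_prod_type, vonNeumannEntropy_eq_sum hM.isHermitian,
    ← sum_eigenvalues_eq_re_trace hM.isHermitian, Finset.sum_mul, ← Finset.sum_add_distrib]
  refine Finset.sum_le_sum fun l _ => ?_
  have h2 : ∑ k, ∑ i, ‖W i (l, k)‖ ^ 2 = hM.isHermitian.eigenvalues l := by
    rw [← hVr l, Fintype.sum_prod_type_right]
    rfl
  rw [← h2]
  exact sum_negMulLog_le _ fun k => by positivity

theorem posSemidef_partialTrace {m n : Type*} [Fintype n] {M : Matrix (m × n) (m × n) ℂ} (hM : M.PosSemidef) :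
    (partialTrace M).PosSemidef := by
  have h1 : partialTrace M = ∑ k, M.submatrix (fun i => (i, k)) (fun i => (i, k)) := by
    ext i j
    rw [partialTrace, of_apply, Matrix.sum_apply]
    rfl
  rw [h1]
  exact posSemidef_sum _ fun k _ => hM.submatrix _

theorem trace_partialTrace {m n : Type*} [Fintype m] [Fintype n] (M : Matrix (m × n) (m × n) ℂ) :
    (partialTrace M).trace = M.trace := by
  simp only [trace, partialTrace, diag_apply, of_apply, Fintype.sum_prod_type]

/-- `M` is measured in the product of an eigenbasis of its partial trace with the standard basis.
The outcome weights over a fixed eigenvector sum to its eigenvalue, so again at most `log (card n)`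
per unit of mass is added. -/
theorem vonNeumannEntropy_le_partialTrace [Nonempty n] {M : Matrix (m × n) (m × n) ℂ}
    (hM : M.PosSemidef) :
    vonNeumannEntropy M ≤
      vonNeumannEntropy (partialTrace M) + M.trace.re * log (Fintype.card n) := by
  have hP := posSemidef_partialTrace hM
  have hU : (hP.isHermitian.eigenvectorUnitary : Matrix m m ℂ) *
      (hP.isHermitian.eigenvectorUnitary : Matrix m m ℂ)ᴴ = 1 :=
    Unitary.mul_star_self_of_mem hP.isHermitian.eigenvectorUnitary.2
  have hD := eigenvectorUnitary_conj_mul hP.isHermitian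
  rw [vonNeumannEntropy_eq_sum hP.isHermitian, ← trace_partialTrace,
    ← sum_eigenvalues_eq_re_trace hP.isHermitian]
  set U : Matrix m m ℂ := hP.isHermitian.eigenvectorUnitary.1
  set r := hP.isHermitian.eigenvalues
  set F : Matrix (m × n) (m × n) ℂ := kroneckerMap (· * ·) U (1 : Matrix n n ℂ) with hFdef
  have hF : F * Fᴴ = 1 := by
    rw [hFdef, conjTranspose_kronecker, ← mul_kronecker_mul, hU, conjTranspose_one, Matrix.mul_one,
      one_kronecker_one]
  refine (vonNeumannEntropy_le_of_basis hM F hF).trans ?_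
  have h0 : ∀ x, 0 ≤ ((Fᴴ * M * F) x x).re := fun x =>
    (Complex.le_def.1 (hM.conjTranspose_mul_mul_same F).diag_nonneg).1
  have h1 : ∀ i, ∑ k, ((Fᴴ * M * F) (i, k) (i, k)).re = r i := by
    intro i
    have h2 : ∀ k, (Fᴴ * M * F) (i, k) (i, k) =
        ∑ j', (∑ j, star (U j i) * M (j, k) (j', k)) * U j' i := by
      intro k
      simp only [mul_apply, hFdef, conjTranspose_apply, kroneckerMap_apply, Fintype.sum_prod_type,
        one_apply, mul_ite, mul_one, mul_zero, ite_mul, zero_mul, apply_ite star,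
        star_zero, Finset.sum_ite_eq', Finset.mem_univ, if_true]
    have h3 : (Uᴴ * partialTrace M * U) i i = ∑ k, (Fᴴ * M * F) (i, k) (i, k) := by
      simp only [h2, mul_apply, partialTrace, of_apply, conjTranspose_apply]
      rw [Finset.sum_comm]
      refine Finset.sum_congr rfl fun j' _ => ?_
      rw [← Finset.sum_mul, Finset.sum_comm]
      simp only [Finset.mul_sum]
    rw [hD, diagonal_apply_eq] at h3
    rw [← Complex.re_sum, ← h3, Complex.ofReal_re]
  rw [Fintype.sum_prod_type, Finset.sum_mul, ← Finset.sum_add_distrib]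
  refine Finset.sum_le_sum fun i _ => ?_
  rw [← h1 i]
  exact sum_negMulLog_le _ fun k => h0 _

end Quantum

/-! ### A Fannes-type continuity estimate -/

section Continuity

open Matrix Real
open scoped ComplexOrder

variable {n : Type*} [Fintype n] [DecidableEq n]

/-- A continuity estimate of Fannes type, with the trace distance expressed by a self-adjoint
contraction. -/
theorem vonNeumannEntropy_sub_le [Nonempty n] {ρ σ : Matrix n n ℂ} (hρ : ρ.PosSemidef)
    (hσ : σ.PosSemidef) (hρ1 : ρ.trace = 1) (hσ1 : σ.trace = 1) :
    ∃ A : Matrix n n ℂ, IsSelfAdjoint A ∧ ‖A‖ = 1 ∧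
      vonNeumannEntropy ρ - vonNeumannEntropy σ ≤
        log (Fintype.card n) * (((ρ - σ) * A).trace).re + 2 * log 2 := by
  have hΔ : (ρ - σ).IsHermitian := hρ.isHermitian.sub hσ.isHermitian
  have hU : (hΔ.eigenvectorUnitary : Matrix n n ℂ)ᴴ * (hΔ.eigenvectorUnitary : Matrix n n ℂ) = 1 :=
    Unitary.star_mul_self_of_mem hΔ.eigenvectorUnitary.2
  have hU' : (hΔ.eigenvectorUnitary : Matrix n n ℂ) * (hΔ.eigenvectorUnitary : Matrix n n ℂ)ᴴ = 1 :=
    Unitary.mul_star_self_of_mem hΔ.eigenvectorUnitary.2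
  have hD := eigenvectorUnitary_conj_mul hΔ
  have hΔU := eq_eigenvectorUnitary_mul hΔ
  set U : Matrix n n ℂ := hΔ.eigenvectorUnitary.1
  set δ := hΔ.eigenvalues
  have hδ0 : ∑ i, δ i = 0 := by
    rw [sum_eigenvalues_eq_re_trace hΔ, trace_sub, hρ1, hσ1]
    simp
  -- The sign at 0 is taken to be +1, so that the sign of `ρ - σ` squares to one and has norm
  -- exactly one.
  set s : n → ℝ := fun i => if 0 ≤ δ i then 1 else -1 with hs
  have hsabs : ∀ i, δ i * s i = |δ i| := by
    intro i
    simp only [hs]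
    split_ifs with h
    · rw [abs_of_nonneg h, mul_one]
    · rw [abs_of_neg (not_le.1 h), mul_neg_one]
  set S : Matrix n n ℂ := diagonal fun i => (s i : ℂ) with hS
  have hSH : Sᴴ = S := by
    rw [hS, diagonal_conjTranspose]
    congr 1
    ext i
    simp
  have hSS : S * S = 1 := by
    rw [hS, diagonal_mul_diagonal, ← diagonal_one]
    congr 1
    ext i
    simp only [hs]
    split_ifs <;> simp
  have hA : (U * S * Uᴴ)ᴴ = U * S * Uᴴ := by
    rw [conjTranspose_mul, conjTranspose_mul, conjTranspose_conjTranspose, hSH, Matrix.mul_assoc]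
  have hAA : (U * S * Uᴴ) * (U * S * Uᴴ) = 1 := by
    calc (U * S * Uᴴ) * (U * S * Uᴴ) = U * (S * (Uᴴ * U) * S) * Uᴴ := by
          simp only [Matrix.mul_assoc]
      _ = 1 := by rw [hU, Matrix.mul_one, hSS, Matrix.mul_one, hU']
  refine ⟨U * S * Uᴴ, hA, ?_, ?_⟩
  · refine CStarRing.norm_of_mem_unitary (Unitary.mem_iff.2 ?_)
    rw [star_eq_conjTranspose, hA]
    exact ⟨hAA, hAA⟩
  have htr : (((ρ - σ) * (U * S * Uᴴ)).trace).re = ∑ i, |δ i| := by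
    rw [← Matrix.mul_assoc, trace_mul_comm, ← Matrix.mul_assoc, ← Matrix.mul_assoc, hD, hS,
      diagonal_mul_diagonal, trace_diagonal, Complex.re_sum]
    exact Finset.sum_congr rfl fun i _ => by
      rw [← Complex.ofReal_mul, Complex.ofReal_re, hsabs]
  rw [htr]
  set p : n → ℝ := fun i => max (δ i) 0 with hp
  set q : n → ℝ := fun i => max (-δ i) 0 with hq
  have hp0 : ∀ i, 0 ≤ p i := fun i => le_max_right _ _
  have hq0 : ∀ i, 0 ≤ q i := fun i => le_max_right _ _
  have hpq : ∀ i, p i - q i = δ i := fun i => max_zero_sub_max_neg_zero_eq_self (δ i)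
  set ε := ∑ i, p i with hε
  have hε0 : 0 ≤ ε := Finset.sum_nonneg fun i _ => hp0 i
  have hεq : ∑ i, q i = ε := by
    have h : ∑ i, (p i - q i) = 0 := by simpa only [hpq] using hδ0
    rw [Finset.sum_sub_distrib] at h
    linarith
  have hεδ : ε ≤ ∑ i, |δ i| := Finset.sum_le_sum fun i _ => max_le (le_abs_self _) (abs_nonneg _)
  -- In the eigenbasis of `ρ - σ` each positive part is at most the diagonal entry of `ρ`, and these
  -- sum to one.
  have hε1 : ε ≤ 1 := by
    have h1 : ∑ i, ((Uᴴ * ρ * U) i i).re = 1 := by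
      have h2 : (Uᴴ * ρ * U).trace = 1 := by
        rw [trace_mul_comm, ← Matrix.mul_assoc, hU', Matrix.one_mul, hρ1]
      rw [← Complex.re_sum]
      exact congrArg Complex.re h2
    rw [← h1]
    refine Finset.sum_le_sum fun i _ => ?_
    have h3 : 0 ≤ ((Uᴴ * ρ * U) i i).re :=
      (Complex.le_def.1 (hρ.conjTranspose_mul_mul_same U).diag_nonneg).1
    have h4 : 0 ≤ ((Uᴴ * σ * U) i i).re :=
      (Complex.le_def.1 (hσ.conjTranspose_mul_mul_same U).diag_nonneg).1
    have h5 : ((Uᴴ * ρ * U) i i).re - ((Uᴴ * σ * U) i i).re = δ i := by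
      have h6 := congrFun (congrFun hD i) i
      rw [Matrix.mul_sub, Matrix.sub_mul, Matrix.sub_apply, diagonal_apply_eq] at h6
      rw [← Complex.sub_re, h6, Complex.ofReal_re]
    exact max_le (by linarith) h3
  obtain ⟨VP, hVP, hVP'⟩ := exists_conj_diagonal_eq_mul_conjTranspose hU p hp0
  obtain ⟨VN, hVN, -⟩ := exists_conj_diagonal_eq_mul_conjTranspose hU q hq0
  obtain ⟨Vσ, hVσ, hVσ'⟩ := exists_eq_mul_conjTranspose hσ
  set P := VP * VPᴴ with hP
  set N := VN * VNᴴ with hN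
  have hNpos : N.PosSemidef := posSemidef_self_mul_conjTranspose VN
  have hPN : ρ - σ = P - N := by
    rw [hΔU, ← hVP, ← hVN, ← Matrix.sub_mul, ← Matrix.mul_sub, diagonal_sub]
    congr 3
    ext i
    rw [← hpq i]
    push_cast
    rfl
  -- With `P` and `N` the positive and negative parts of `ρ - σ`, this common matrix is the
  -- intermediary. Its entropy is bounded above through `σ + P` and below through `ρ + N`; the term
  -- `negMulLog ε` occurs in both bounds and cancels.
  have hΩ : ρ + N = σ + P := by
    have h := sub_eq_iff_eq_add.1 hPN
    rw [h]
    abel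
  have hupper : vonNeumannEntropy (ρ + N) ≤
      vonNeumannEntropy σ + (negMulLog ε + ε * log (Fintype.card n)) := by
    -- Joining the eigenvectors of `σ` and `P` gives a rank-one decomposition whose weights are the
    -- two spectra.
    have h1 : ρ + N = fromCols Vσ VP * (fromCols Vσ VP)ᴴ := by
      rw [conjTranspose_fromCols_eq_fromRows_conjTranspose, fromCols_mul_fromRows, ← hVσ]
      exact hΩ
    have h2 := vonNeumannEntropy_mul_conjTranspose_le (fromCols Vσ VP)
    rw [Fintype.sum_sum_type] at h2
    simp only [fromCols_apply_inl, fromCols_apply_inr, hVσ',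
      sum_norm_sq_eq_of_conjTranspose_mul_self hVP'] at h2
    rw [h1, vonNeumannEntropy_eq_sum hσ.isHermitian]
    exact h2.trans (add_le_add le_rfl (sum_negMulLog_le p hp0))
  have hlower : vonNeumannEntropy ρ + negMulLog ε ≤
      vonNeumannEntropy (ρ + N) + (1 + ε) * log 2 := by
    have hpos : (ρ + N).PosSemidef := hρ.add hNpos
    have hG := eigenvectorUnitary_conj_mul hpos.isHermitian
    have hGG : (hpos.isHermitian.eigenvectorUnitary : Matrix n n ℂ) *
        (hpos.isHermitian.eigenvectorUnitary : Matrix n n ℂ)ᴴ = 1 :=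
      Unitary.mul_star_self_of_mem hpos.isHermitian.eigenvectorUnitary.2
    rw [vonNeumannEntropy_eq_sum hpos.isHermitian]
    set G : Matrix n n ℂ := hpos.isHermitian.eigenvectorUnitary.1
    -- Both summands are measured in the eigenbasis of `ρ + N`, where the weights add up to its
    -- eigenvalues; separating each eigenvalue into two parts costs `log 2` per unit of the total
    -- mass `1 + ε`.
    set a : n → ℝ := fun k => ((Gᴴ * ρ * G) k k).re with ha
    set b : n → ℝ := fun k => ((Gᴴ * N * G) k k).re with hb
    have ha0 : ∀ k, 0 ≤ a k := fun k =>
      (Complex.le_def.1 (hρ.conjTranspose_mul_mul_same G).diag_nonneg).1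
    have hb0 : ∀ k, 0 ≤ b k := fun k =>
      (Complex.le_def.1 (hNpos.conjTranspose_mul_mul_same G).diag_nonneg).1
    have hab : ∀ k, hpos.isHermitian.eigenvalues k = a k + b k := by
      intro k
      have h6 := congrFun (congrFun hG k) k
      rw [Matrix.mul_add, Matrix.add_mul, Matrix.add_apply, diagonal_apply_eq] at h6
      rw [ha, hb, ← Complex.add_re, h6, Complex.ofReal_re]
    have htrG : ∀ M : Matrix n n ℂ, ∑ k, ((Gᴴ * M * G) k k).re = M.trace.re := by
      intro M
      have h2 : (Gᴴ * M * G).trace = M.trace := by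
        rw [trace_mul_comm, ← Matrix.mul_assoc, hGG, Matrix.one_mul]
      rw [← Complex.re_sum, ← h2]
      rfl
    have hsa : ∑ k, a k = 1 := by rw [htrG, hρ1, Complex.one_re]
    have hsb : ∑ k, b k = ε := by
      rw [htrG, ← hVN, trace_mul_comm, ← Matrix.mul_assoc, hU, Matrix.one_mul, trace_diagonal,
        Complex.re_sum, ← hεq]
      simp only [Complex.ofReal_re]
    have h1 : vonNeumannEntropy ρ ≤ ∑ k, negMulLog (a k) := vonNeumannEntropy_le_of_basis hρ G hGG
    have h2 : negMulLog ε ≤ ∑ k, negMulLog (b k) := by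
      rw [← hsb]
      exact negMulLog_sum_le _ _ fun k _ => hb0 k
    have h3 : ∑ k, (negMulLog (a k) + negMulLog (b k)) ≤
        ∑ k, (negMulLog (a k + b k) + (a k + b k) * log 2) :=
      Finset.sum_le_sum fun k _ => negMulLog_add_le (ha0 k) (hb0 k)
    simp only [Finset.sum_add_distrib, ← Finset.sum_mul, hsa, hsb] at h3
    simp only [hab]
    linarith
  have hl2 : 0 ≤ log 2 := log_nonneg (by norm_num)
  have hld : 0 ≤ log (Fintype.card n) := log_natCast_nonneg _
  have h1 : ε * log (Fintype.card n) ≤ log (Fintype.card n) * ∑ i, |δ i| := by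
    rw [mul_comm]
    exact mul_le_mul_of_nonneg_left hεδ hld
  have h2 : (1 + ε) * log 2 ≤ 2 * log 2 := mul_le_mul_of_nonneg_right (by linarith) hl2
  linarith

end Continuity

/-! ### States and their density matrices -/

section States

open scoped Matrix ComplexOrder MatrixOrder

variable {ν D : ℕ} [NeZero D]

theorem exists_algebraMap_norm_sub_eq {A : QuasiLocal ν D} (hA : IsSelfAdjoint A) :
    ∃ B : QuasiLocal ν D, ((‖A‖ : ℝ) : ℂ) • (1 : QuasiLocal ν D) - A = star B * B := by
  let _ := CStarAlgebra.spectralOrder (QuasiLocal ν D)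
  let _ := CStarAlgebra.spectralOrderedRing (QuasiLocal ν D)
  have h1 := sub_nonneg.2 hA.le_algebraMap_norm_self
  obtain ⟨B, hB⟩ := CStarAlgebra.nonneg_iff_eq_star_mul_self.1 h1
  refine ⟨B, ?_⟩
  rw [← hB, Algebra.algebraMap_eq_smul_one, Complex.coe_smul]

variable {φ : QuasiLocal ν D →ₗ[ℂ] ℂ}

theorem IsState.apply_isSelfAdjoint (hφ : IsState φ) {A : QuasiLocal ν D}
    (hA : IsSelfAdjoint A) : (φ A).im = 0 ∧ (φ A).re ≤ ‖A‖ := by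
  obtain ⟨B, hB⟩ := exists_algebraMap_norm_sub_eq hA
  have h1 := hφ.im_eq_zero B
  have h2 := hφ.re_nonneg B
  rw [← hB, map_sub, map_smul, hφ.map_one, smul_eq_mul, mul_one] at h1 h2
  simp only [Complex.sub_im, Complex.sub_re, Complex.ofReal_im, Complex.ofReal_re] at h1 h2
  constructor <;> linarith

/-- The self-adjoint elements `A + star A` and `i (A - star A)` have real values, which fixes the
imaginary and real parts respectively. -/
theorem IsState.apply_star (hφ : IsState φ) (A : QuasiLocal ν D) : φ (star A) = star (φ A) := by
  have h1 := hφ.apply_isSelfAdjoint (IsSelfAdjoint.add_star_self A)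
  have h2 : IsSelfAdjoint (Complex.I • (A - star A)) := by
    rw [IsSelfAdjoint, star_smul, star_sub, star_star, Complex.star_def, Complex.conj_I, neg_smul,
      ← smul_neg, neg_sub]
  have h3 := hφ.apply_isSelfAdjoint h2
  simp only [map_add, map_smul, map_sub, smul_eq_mul] at h1 h3
  apply Complex.ext
  · have := h3.1
    simp at this ⊢
    linarith
  · have := h1.1
    simp at this ⊢
    linarith

theorem densityMatrix_apply (φ : QuasiLocal ν D → ℂ) (Λ : Finset (Site ν)) (σ η : Config D Λ) :
    densityMatrix φ Λ σ η = φ (incl Λ (Matrix.single η σ 1)) := rfl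

theorem IsState.isHermitian_densityMatrix (hφ : IsState φ) (Λ : Finset (Site ν)) :
    (densityMatrix φ Λ).IsHermitian := by
  ext σ η
  rw [Matrix.conjTranspose_apply, densityMatrix_apply, densityMatrix_apply, ← hφ.apply_star,
    ← map_star, Matrix.star_eq_conjTranspose, Matrix.conjTranspose_single, star_one]

theorem IsState.posSemidef_densityMatrix (hφ : IsState φ) (Λ : Finset (Site ν)) :
    (densityMatrix φ Λ).PosSemidef := by
  refine Matrix.PosSemidef.of_dotProduct_mulVec_nonneg (hφ.isHermitian_densityMatrix Λ)
    fun x => ?_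
  -- The quadratic form at `x` is the state evaluated on the rank-one positive matrix built from
  -- `x`, written as `star B * B`.
  obtain ⟨B, hB⟩ := CStarAlgebra.nonneg_iff_eq_star_mul_self.1
    (Matrix.posSemidef_vecMulVec_self_star x).nonneg
  have h1 : star x ⬝ᵥ densityMatrix φ Λ *ᵥ x = φ (star (incl Λ B) * incl Λ B) := by
    rw [← map_star, ← map_mul, ← hB, ← trace_densityMatrix_mul, Matrix.mul_vecMulVec,
      Matrix.trace_vecMulVec, dotProduct_comm]
  rw [h1, Complex.le_def]
  exact ⟨hφ.re_nonneg _, (hφ.im_eq_zero _).symm⟩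

theorem IsState.trace_densityMatrix (hφ : IsState φ) (Λ : Finset (Site ν)) :
    (densityMatrix φ Λ).trace = 1 := by
  have h := trace_densityMatrix_mul φ Λ 1
  rwa [Matrix.mul_one, _root_.map_one, hφ.map_one] at h

end States

/-! ### Evolved states, restriction to subregions and comparison of entropies -/

section EvolvedStates

open scoped ComplexOrder

variable {ν D : ℕ} [NeZero D] {Φ : (X : Finset (Site ν)) → LocalAlgebra D X}

/-- The finite-region evolution as a linear map. -/
def localEvolutionₗ (Φ : (X : Finset (Site ν)) → LocalAlgebra D X) (Λ : Finset (Site ν)) (t : ℝ) :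
    QuasiLocal ν D →ₗ[ℂ] QuasiLocal ν D where
  toFun := localEvolution Φ Λ t
  map_add' := localEvolution_add Φ Λ t
  map_smul' := localEvolution_smul Φ Λ t

/-- The infinite-volume evolution as a linear map. -/
def evolutionₗ (hΦ : IsTwoBodyInteraction Φ) (t : ℝ) : QuasiLocal ν D →ₗ[ℂ] QuasiLocal ν D where
  toFun := evolution Φ t
  map_add' := evolution_add hΦ t
  map_smul' := evolution_smul hΦ t

variable {ω : QuasiLocal ν D →ₗ[ℂ] ℂ}

theorem IsState.comp_of_map (hω : IsState ω) (T : QuasiLocal ν D →ₗ[ℂ] QuasiLocal ν D)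
    (h1 : T 1 = 1) (h2 : ∀ A, T (star A * A) = star (T A) * T A) : IsState (ω ∘ₗ T) where
  im_eq_zero A := by
    rw [LinearMap.comp_apply, h2]
    exact hω.im_eq_zero _
  re_nonneg A := by
    rw [LinearMap.comp_apply, h2]
    exact hω.re_nonneg _
  map_one := by rw [LinearMap.comp_apply, h1, hω.map_one]

theorem IsState.comp_evolution (hω : IsState ω) (hΦ : IsTwoBodyInteraction Φ) (t : ℝ) :
    IsState (ω ∘ₗ evolutionₗ hΦ t) :=
  hω.comp_of_map _ (evolution_one hΦ t) fun A =>
    (evolution_mul hΦ t _ _).trans (congrArg (· * _) (evolution_star hΦ t A))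

theorem IsState.comp_localEvolution (hω : IsState ω) (hΦ : IsTwoBodyInteraction Φ)
    (Λ : Finset (Site ν)) (t : ℝ) : IsState (ω ∘ₗ localEvolutionₗ Φ Λ t) :=
  hω.comp_of_map _ (localEvolution_one hΦ Λ t) fun A =>
    (localEvolution_mul hΦ Λ t _ _).trans (congrArg (· * _) (localEvolution_star hΦ Λ t A))

theorem continuous_incl (Λ : Finset (Site ν)) :
    Continuous (incl Λ : LocalAlgebra D Λ → QuasiLocal ν D) :=
  (AddMonoidHomClass.isometry_of_norm (incl Λ) (norm_incl Λ)).continuous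

theorem incl_exp (Λ : Finset (Site ν)) (A : LocalAlgebra D Λ) :
    incl Λ (NormedSpace.exp A) = NormedSpace.exp (incl Λ A) := by
  let _ : NormedAlgebra ℚ (LocalAlgebra D Λ) := NormedAlgebra.restrictScalars ℚ ℂ _
  let _ : Algebra ℚ (QuasiLocal ν D) := RestrictScalars.algebra ℚ ℂ (QuasiLocal ν D)
  exact NormedSpace.map_exp (incl Λ) (continuous_incl Λ) A

/-- Cyclicity of the trace moves the exponentials from the density matrix to the observable. -/
theorem evolvedDensity_densityMatrix (Φ : (X : Finset (Site ν)) → LocalAlgebra D X)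
    (ω : QuasiLocal ν D →ₗ[ℂ] ℂ) (Λ : Finset (Site ν)) (t : ℝ) :
    evolvedDensity Φ Λ t (densityMatrix ω Λ) = densityMatrix (ω ∘ₗ localEvolutionₗ Φ Λ t) Λ := by
  have hentry : ∀ (M : LocalAlgebra D Λ) (σ η : Config D Λ),
      M σ η = (M * Matrix.single η σ 1).trace := by
    intro M σ η
    rw [Matrix.trace_mul_single]
    simp
  have h1 : ∀ A : LocalAlgebra D Λ,
      (evolvedDensity Φ Λ t (densityMatrix ω Λ) * A).trace = ω (localEvolution Φ Λ t (incl Λ A)) := by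
    intro A
    rw [localEvolution, ← map_smul, ← map_smul, ← incl_exp, ← incl_exp, ← map_mul, ← map_mul,
      ← trace_densityMatrix_mul, evolvedDensity, mul_assoc, mul_assoc, Matrix.trace_mul_comm]
    simp only [mul_assoc]
  exact Matrix.ext fun σ η => (hentry _ σ η).trans (h1 _)

/-- A configuration on `Λ` is a pair of configurations on `Λ₀` and on `Λ ∖ Λ₀`. -/
def configProd {ν : ℕ} {Λ₀ Λ : Finset (Site ν)} (D : ℕ) (h : Λ₀ ⊆ Λ) :
    Config D Λ₀ × Config D (Λ \ Λ₀) ≃ Config D Λ where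
  toFun p x := if hx : x.1 ∈ Λ₀ then p.1 ⟨x.1, hx⟩ else p.2 ⟨x.1, Finset.mem_sdiff.2 ⟨x.2, hx⟩⟩
  invFun σ := (restrict h σ, restrict Finset.sdiff_subset σ)
  left_inv p := by
    refine Prod.ext (funext fun x => ?_) (funext fun x => ?_)
    · simp [restrict]
    · simp [restrict, (Finset.mem_sdiff.1 x.2).2]
  right_inv σ := by
    funext x
    by_cases hx : x.1 ∈ Λ₀ <;> simp [restrict, hx]

theorem restrict_configProd {ν D : ℕ} {Λ₀ Λ : Finset (Site ν)} (h : Λ₀ ⊆ Λ)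
    (p : Config D Λ₀ × Config D (Λ \ Λ₀)) : restrict h (configProd D h p) = p.1 :=
  congrArg Prod.fst ((configProd D h).symm_apply_apply p)

theorem agreeOff_configProd {ν D : ℕ} {Λ₀ Λ : Finset (Site ν)} (h : Λ₀ ⊆ Λ)
    (p q : Config D Λ₀ × Config D (Λ \ Λ₀)) :
    AgreeOff Λ₀ (configProd D h p) (configProd D h q) ↔ p.2 = q.2 := by
  constructor
  · intro hpq
    funext x
    have hx := Finset.mem_sdiff.1 x.2
    have h1 := hpq ⟨x.1, hx.1⟩ hx.2
    simpa [configProd, hx.2] using h1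
  · intro hpq x hx
    simp [configProd, hx, hpq]

/-- A matrix unit tensored with the identity is a sum of matrix units over configurations of the
complement; this turns restriction of a functional into a partial trace. -/
theorem embed_single {ν D : ℕ} {Λ₀ Λ : Finset (Site ν)} (h : Λ₀ ⊆ Λ) (σ η : Config D Λ₀) :
    embed h (Matrix.single η σ (1 : ℂ)) =
      ∑ k, Matrix.single (configProd D h (η, k)) (configProd D h (σ, k)) 1 := by
  ext a b
  obtain ⟨p, rfl⟩ := (configProd D h).surjective a
  obtain ⟨q, rfl⟩ := (configProd D h).surjective b
  obtain ⟨p₁, p₂⟩ := p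
  obtain ⟨q₁, q₂⟩ := q
  rw [embed_apply, restrict_configProd, restrict_configProd, Matrix.sum_apply]
  simp only [agreeOff_configProd, Matrix.single_apply, (configProd D h).injective.eq_iff,
    Prod.mk.injEq]
  by_cases hpq : p₂ = q₂
  · subst hpq
    rw [if_pos rfl, Finset.sum_eq_single p₂]
    · simp
    · intro k _ hk
      simp [hk]
    · simp
  · rw [if_neg hpq]
    refine (Finset.sum_eq_zero fun k _ => if_neg ?_).symm
    rintro ⟨⟨_, rfl⟩, _, rfl⟩
    exact hpq rfl

theorem densityMatrix_eq_partialTrace (φ : QuasiLocal ν D →ₗ[ℂ] ℂ) {Λ₀ Λ : Finset (Site ν)}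
    (h : Λ₀ ⊆ Λ) :
    densityMatrix φ Λ₀ =
      partialTrace ((densityMatrix φ Λ).submatrix (configProd D h) (configProd D h)) := by
  ext σ η
  rw [densityMatrix_apply, ← incl_embed h, embed_single, map_sum, map_sum]
  rfl

theorem log_card_config {ν : ℕ} (D : ℕ) (Λ : Finset (Site ν)) :
    Real.log (Fintype.card (Config D Λ)) = Λ.card * Real.log D := by
  simp

theorem entropy_eq_vonNeumannEntropy {ν D : ℕ} {Λ : Finset (Site ν)} (ρ : LocalAlgebra D Λ) :
    entropy ρ = vonNeumannEntropy ρ := rfl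

variable {φ ψ : QuasiLocal ν D →ₗ[ℂ] ℂ}

/-- Restricting a state to a subregion changes the entropy by at most the logarithm of the dimension
of the complement. -/
theorem IsState.abs_entropy_densityMatrix_sub_le (hφ : IsState φ) {Λ₀ Λ : Finset (Site ν)}
    (h : Λ₀ ⊆ Λ) :
    |entropy (densityMatrix φ Λ) - entropy (densityMatrix φ Λ₀)| ≤
      (Λ \ Λ₀).card * Real.log D := by
  have hpos := hφ.posSemidef_densityMatrix Λ
  have hpos' := hpos.submatrix (configProd D h)
  have htr : ((densityMatrix φ Λ).submatrix (configProd D h) (configProd D h)).trace = 1 := by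
    rw [← trace_partialTrace, ← densityMatrix_eq_partialTrace, hφ.trace_densityMatrix]
  have h1 := vonNeumannEntropy_partialTrace_le hpos'
  have h2 := vonNeumannEntropy_le_partialTrace hpos'
  rw [← densityMatrix_eq_partialTrace, vonNeumannEntropy_submatrix hpos, htr, Complex.one_re,
    one_mul, log_card_config] at h1 h2
  rw [entropy_eq_vonNeumannEntropy, entropy_eq_vonNeumannEntropy, abs_le]
  constructor <;> linarith

theorem IsState.entropy_densityMatrix_sub_le (hφ : IsState φ) (hψ : IsState ψ)
    (Λ : Finset (Site ν)) {s : ℝ}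
    (hs : ∀ A : LocalAlgebra D Λ, IsSelfAdjoint A → ‖A‖ = 1 →
      (φ (incl Λ A) - ψ (incl Λ A)).re ≤ s) :
    entropy (densityMatrix φ Λ) - entropy (densityMatrix ψ Λ) ≤
      Λ.card * Real.log D * s + Real.exp 1 := by
  obtain ⟨A, hA, hA1, hAS⟩ := vonNeumannEntropy_sub_le (hφ.posSemidef_densityMatrix Λ)
    (hψ.posSemidef_densityMatrix Λ) (hφ.trace_densityMatrix Λ) (hψ.trace_densityMatrix Λ)
  rw [Matrix.sub_mul, Matrix.trace_sub, trace_densityMatrix_mul, trace_densityMatrix_mul,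
    log_card_config] at hAS
  -- The constant of the Fannes-type bound is absorbed by `2 log 2 ≤ 2 ≤ e`.
  have h1 := Real.log_le_sub_one_of_pos (show (0 : ℝ) < 2 by norm_num)
  have h2 := Real.add_one_le_exp 1
  have h3 : (Λ.card : ℝ) * Real.log D * (φ (incl Λ A) - ψ (incl Λ A)).re ≤
      Λ.card * Real.log D * s :=
    mul_le_mul_of_nonneg_left (hs A hA hA1)
      (mul_nonneg (Nat.cast_nonneg _) (Real.log_natCast_nonneg _))
  rw [entropy_eq_vonNeumannEntropy, entropy_eq_vonNeumannEntropy]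
  linarith

theorem IsState.re_evolution_sub_le (hω : IsState ω) (hΦ : IsTwoBodyInteraction Φ)
    (Λ₀ Λ : Finset (Site ν)) (t : ℝ) {A : LocalAlgebra D Λ₀} (hA : IsSelfAdjoint A)
    (hA1 : ‖A‖ = 1) :
    |(ω (evolution Φ t (incl Λ₀ A)) - ω (localEvolution Φ Λ t (incl Λ₀ A))).re| ≤
      ⨆ A : {A : LocalAlgebra D Λ₀ // ‖A‖ = 1},
        ‖evolution Φ t (incl Λ₀ A.1) - localEvolution Φ Λ t (incl Λ₀ A.1)‖ := by
  -- A real supremum dominates its members only if the family is bounded; the bound 2 comes from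
  -- both evolutions being isometric.
  have hbdd : BddAbove (Set.range fun A : {A : LocalAlgebra D Λ₀ // ‖A‖ = 1} =>
      ‖evolution Φ t (incl Λ₀ A.1) - localEvolution Φ Λ t (incl Λ₀ A.1)‖) := by
    refine ⟨2, ?_⟩
    rintro _ ⟨B, rfl⟩
    refine (norm_sub_le _ _).trans ?_
    rw [norm_evolution hΦ, norm_localEvolution hΦ, norm_incl, B.2]
    norm_num
  refine le_trans ?_ (le_ciSup hbdd ⟨A, hA1⟩)
  have hsa : IsSelfAdjoint (evolution Φ t (incl Λ₀ A) - localEvolution Φ Λ t (incl Λ₀ A)) := by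
    rw [IsSelfAdjoint, star_sub, ← evolution_star hΦ, ← localEvolution_star hΦ,
      (hA.map (incl Λ₀)).star_eq]
  have h1 := (hω.apply_isSelfAdjoint hsa).2
  have h2 := (hω.apply_isSelfAdjoint hsa.neg).2
  rw [map_neg, norm_neg, Complex.neg_re] at h2
  rw [← map_sub, abs_le]
  constructor
  · exact neg_le.1 h2
  · exact h1

end EvolvedStates

end

end SpinSystem

/-! ### The entropy estimate -/

theorem proposition3p6p4 {ν D : ℕ} [NeZero D]
    (Φ : (X : Finset (SpinSystem.Site ν)) → SpinSystem.LocalAlgebra D X)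
    (hΦ : SpinSystem.IsTwoBodyInteraction Φ)
    (ω : SpinSystem.QuasiLocal ν D →ₗ[ℂ] ℂ) (hω : SpinSystem.IsState ω)
    (Λ₀ Λ : Finset (SpinSystem.Site ν)) (hΛ : Λ₀ ⊆ Λ) (t : ℝ) :
    (∀ A : SpinSystem.QuasiLocal ν D,
      Tendsto (fun Λ' : Finset (SpinSystem.Site ν) => SpinSystem.localEvolution Φ Λ' t A) atTop
        (𝓝 (SpinSystem.evolution Φ t A))) ∧
    |SpinSystem.entropy
          (SpinSystem.densityMatrix (fun A => ω (SpinSystem.evolution Φ t A)) Λ) -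
        SpinSystem.entropy
          (SpinSystem.evolvedDensity Φ Λ t (SpinSystem.densityMatrix ω Λ))| ≤
      (Λ₀.card : ℝ) * Real.log D *
          (⨆ A : {A : SpinSystem.LocalAlgebra D Λ₀ // ‖A‖ = 1},
            ‖SpinSystem.evolution Φ t (SpinSystem.incl Λ₀ A.1) -
              SpinSystem.localEvolution Φ Λ t (SpinSystem.incl Λ₀ A.1)‖) +
        (Real.exp 1 + 2 * ((Λ \ Λ₀).card : ℝ) * Real.log D) := by
  refine ⟨fun A => SpinSystem.tendsto_localEvolution hΦ t A, ?_⟩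
  have hφ := hω.comp_evolution hΦ t
  have hψ := hω.comp_localEvolution hΦ Λ t
  rw [SpinSystem.evolvedDensity_densityMatrix]
  change |SpinSystem.entropy (SpinSystem.densityMatrix (ω ∘ₗ SpinSystem.evolutionₗ hΦ t) Λ) - _| ≤ _
  have h1 := abs_le.1 (hφ.abs_entropy_densityMatrix_sub_le hΛ)
  have h2 := abs_le.1 (hψ.abs_entropy_densityMatrix_sub_le hΛ)
  -- The one-sided continuity estimate is used in both orders of the two states, with the same
  -- supremum because it controls the absolute value.
  have h3 := hφ.entropy_densityMatrix_sub_le hψ Λ₀ fun A hA hA1 =>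
    (le_abs_self _).trans (hω.re_evolution_sub_le hΦ Λ₀ Λ t hA hA1)
  have h4 := hψ.entropy_densityMatrix_sub_le hφ Λ₀ fun A hA hA1 =>
    ((le_abs_self _).trans_eq (by
      rw [← neg_sub, Complex.neg_re, abs_neg]; rfl)).trans (hω.re_evolution_sub_le hΦ Λ₀ Λ t hA hA1)
  rw [abs_le]
  constructor <;> linarith
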